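/- Let $\Gamma_1,\Gamma_2,\Gamma_3,\Gamma_4$ be nonzero real numbers (vorticities) with $L=\sum_{1\le j<k\le 4}\Gamma_j\Gamma_k=0$. For $z=(z_1,\dots,z_4)\in\mathbb C^4$ with pairwise distinct entries put $V_n=\sum_{j\ne n}\Gamma_j/\overline{(z_n-z_j)}$. Call $z$ a relative equilibrium if $V_n=\lambda(z_n-z_0)$ $(1\le n\le 4)$ for some $\lambda\in\mathbb R\setminus\{0\}$, $z_0\in\mathbb C$, and, for $\Lambda\in\mathbb C\setminus\mathbb R$, a collapse configuration with multiplier $\Lambda$ if $V_n=\Lambda(z_n-z_0)$ $(1\le n\le 4)$ for some $z_0\in\mathbb C$. Two configurations $z,z'$ are equivalent if $z'_n=b(z_n+a)$ for all $n$, with some $a,b\in\mathbb C$, $b\ne0$; dilation multiplies the multiplier by a positive factor, so one may normalize $|\Lambda|=1$. For $|\Lambda|=1$, a normalized central configuration in the complex domain with multiplier $\Lambda$ is a solution of the polynomial system in complex unknowns $z_n,w_n$ $(1\le n\le4)$ and $Z_{jk},W_{jk}$ $(1\le j,k\le 4)$ $$\Lambda z_n=\sum_{j\ne n}\Gamma_jZ_{jn},\qquad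 \Lambda^{-1}w_n=\sum_{j\ne n}\Gamma_jW_{jn}\qquad(1\le n\le 4),$$ $$Z_{jk}(w_k-w_j)=1,\qquad W_{jk}(z_k-z_j)=1\quad(j<k),\qquad Z_{jk}=-Z_{kj},\qquad W_{jk}=-W_{kj},\qquad z_2-z_1=w_2-w_1.$$ **Theorem.** (1) There are only finitely many relative equilibria up to equivalence, and the set of all normalized central configurations in the complex domain with $\Lambda\in\{1,-1\}$ is finite. (2) Let $\Lambda\in\mathbb C\setminus\mathbb R$ with $|\Lambda|=1$. Except perhaps when $\Lambda=\pm i$ and, after a permutation of the indices, $\Gamma_1=\Gamma_2$ and $\Gamma_3=\Gamma_4=(\sqrt3-2)^{\pm1}\Gamma_1$, there are only finitely many collapse configurations with multiplier $\Lambda$ up to equivalence, and the set of all normalized central configurations in the complex domain with multiplier $\Lambda$ is finite. -/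

import Mathlib

noncomputable section

namespace FourVortex

/-- The total vortex angular momentum `L = ∑_{j<k} Γ_j Γ_k`. -/
def angularMomentum (Γ : Fin 4 → ℝ) : ℝ :=
  ∑ j, ∑ k ∈ Finset.Ioi j, Γ j * Γ k

/-- `V_n = ∑_{j ≠ n} Γ_j / conj (z_n - z_j)`; the vortices move by `dz_n/dt = -i V_n`. -/
def velocity (Γ : Fin 4 → ℝ) (z : Fin 4 → ℂ) (n : Fin 4) : ℂ :=
  ∑ j ∈ Finset.univ.erase n, (Γ j : ℂ) / (starRingEnd ℂ) (z n - z j)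

/-- A collision-free configuration with `V_n = l (z_n - z₀)` for some real `l ≠ 0` and some
centre `z₀`. -/
def IsRelativeEquilibrium (Γ : Fin 4 → ℝ) (z : Fin 4 → ℂ) : Prop :=
  Function.Injective z ∧
    ∃ (l : ℝ) (z₀ : ℂ), l ≠ 0 ∧ ∀ n, velocity Γ z n = (l : ℂ) * (z n - z₀)

/-- A collapse configuration with multiplier `Λ`: a collision-free configuration with
`V_n = Λ (z_n - z₀)` for some centre `z₀`, where `Λ` is not real. -/
def IsCollapseConfiguration (Γ : Fin 4 → ℝ) (Λ : ℂ) (z : Fin 4 → ℂ) : Prop :=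
  Function.Injective z ∧ Λ.im ≠ 0 ∧
    ∃ z₀ : ℂ, ∀ n, velocity Γ z n = Λ * (z n - z₀)

/-- Equivalence of configurations: `z'` arises from `z` by translation, rotation and dilation. -/
def similarity : Setoid (Fin 4 → ℂ) where
  r z z' := ∃ a b : ℂ, b ≠ 0 ∧ ∀ n, z' n = b * (z n + a)
  iseqv :=
    { refl := fun z => ⟨0, 1, one_ne_zero, fun n => by ring⟩
      symm := by
        rintro z z' ⟨a, b, hb, h⟩
        refine ⟨-(b * a), b⁻¹, inv_ne_zero hb, fun n => ?_⟩
        rw [h n]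
        field_simp
        ring
      trans := by
        rintro z z' z'' ⟨a, b, hb, h⟩ ⟨a', b', hb', h'⟩
        refine ⟨a + a' / b, b' * b, mul_ne_zero hb' hb, fun n => ?_⟩
        rw [h' n, h n]
        field_simp
        ring }

/-- A set of configurations is finite up to translation, rotation and dilation. -/
def FiniteUpToSimilarity (S : Set (Fin 4 → ℂ)) : Prop :=
  (Quotient.mk similarity '' S).Finite

/-- The variables `(z, Z, w, W)` of the complexified problem. -/
abbrev ComplexConfig : Type :=
  (Fin 4 → ℂ) × (Fin 4 → Fin 4 → ℂ) × (Fin 4 → ℂ) × (Fin 4 → Fin 4 → ℂ)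

/-- Normalized central configurations with multiplier `Λ` in the complex domain: `w` takes the
place of the conjugate of `z`, and `Z_{jk} = 1/w_{jk}`, `W_{jk} = 1/z_{jk}`, where
`z_{jk} = z_k - z_j` and `w_{jk} = w_k - w_j`. The last equation removes the rotations
`(z, w) ↦ (a z, a⁻¹ w)`. -/
def IsNormalizedCentral (Γ : Fin 4 → ℝ) (Λ : ℂ) (Q : ComplexConfig) : Prop :=
  let (z, Z, w, W) := Q
  (∀ n, Λ * z n = ∑ j ∈ Finset.univ.erase n, (Γ j : ℂ) * Z j n) ∧
  (∀ n, Λ⁻¹ * w n = ∑ j ∈ Finset.univ.erase n, (Γ j : ℂ) * W j n) ∧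
  (∀ j k, j < k → Z j k * (w k - w j) = 1) ∧
  (∀ j k, j < k → W j k * (z k - z j) = 1) ∧
  (∀ j k, Z j k = -Z k j) ∧
  (∀ j k, W j k = -W k j) ∧
  z 1 - z 0 = w 1 - w 0

/-- The vorticities form two pairs of equal ones, in the ratio `√3 - 2` or its inverse. -/
def IsExceptional (Γ : Fin 4 → ℝ) : Prop :=
  ∃ σ : Equiv.Perm (Fin 4), Γ (σ 0) = Γ (σ 1) ∧ Γ (σ 2) = Γ (σ 3) ∧
    (Γ (σ 2) = (Real.sqrt 3 - 2) * Γ (σ 0) ∨ Γ (σ 2) = (Real.sqrt 3 - 2)⁻¹ * Γ (σ 0))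

end FourVortex

end

/-! Write `F(z)_n = ∑_{j≠n} Γ_j/(z_n - z_j)`. After translation and rescaling, with `u` a multiple
of the conjugate of `z` (or of `w`), every problem in the theorem becomes the symmetric system `u =
F(z)`, `lam * z = F(u)`, where `lam = Λ / conj Λ` has modulus one. It suffices that this system has
finitely many solutions with `z 1 - z 0 = 1` (`finite_dualPairs`).

If there were infinitely many, some component of their Zariski closure would have a generic point
over a field `K ⊋ ℂ`. Fix a pair `i, j`. If no place of `K` made `z_i - z_j` smaller than some other
difference, all ratios `(z_i - z_j)/(z_p - z_q)` would be constant, hence so would the differences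
and, as the center of vorticity is at 0, the positions. So every pair comes together relative to
some other pair at some place (`exists_valuation_lt`).

Such a collision is rigid. Opposite vortices cannot pair up, a cluster of three is impossible, and
two equally tight pairs are incompatible with `‖lam‖ = 1`. Only a single tightest pair survives, and
the limiting equations with `L = 0` give `lam Γ_i Γ_j = -Γ_k Γ_l` and `Γ_i + Γ_j ≠ 0`
(`mult_eq_of_lt`). Imposed on all pairs, these conditions make all `Γ_n` equal, contradicting `L =
0` (`false_of_forall_pairs`). -/

noncomputable section

namespace FourVortex

/-! ### Generic points and places -/

open MvPolynomial in
/-- An infinite set of points of affine space has a generic point with a transcendental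
coordinate. -/
theorem exists_generic_point {ι : Type} [Finite ι] {S : Set (ι → ℂ)} (hS : S.Infinite) :
    ∃ (K : Type) (_ : Field K) (_ : Algebra ℂ K) (x : ι → K),
      (∀ p : MvPolynomial ι ℂ, (∀ s ∈ S, eval s p = 0) → aeval x p = 0) ∧
        ∃ i, x i ∉ Set.range (algebraMap ℂ K) := by
  by_contra hcon
  let I : Ideal (MvPolynomial ι ℂ) := ⨅ s ∈ S, RingHom.ker (eval s)
  have hI : ∀ p : MvPolynomial ι ℂ, (∀ s ∈ S, eval s p = 0) → p ∈ I := by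
    intro p hp
    simpa [I, Ideal.mem_iInf, RingHom.mem_ker] using hp
  have key : ∀ p ∈ I.minimalPrimes, ∃ c : ι → ℂ, ∀ i, X i - C (c i) ∈ p := by
    intro p hp
    by_contra hc
    have hprime : p.IsPrime := hp.1.1
    let R := MvPolynomial ι ℂ ⧸ p
    let φ : MvPolynomial ι ℂ →ₐ[ℂ] FractionRing R :=
      (Algebra.ofId R (FractionRing R)).restrictScalars ℂ |>.comp (Ideal.Quotient.mkₐ ℂ p)
    have hφ : ∀ q, φ q = 0 ↔ q ∈ p := by
      intro q
      change algebraMap R (FractionRing R) (Ideal.Quotient.mk p q) = 0 ↔ _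
      rw [FaithfulSMul.algebraMap_eq_zero_iff, Ideal.Quotient.eq_zero_iff_mem]
    refine hcon ⟨FractionRing R, inferInstance, inferInstance, fun i => φ (X i), ?_, ?_⟩
    · intro q hq
      have : aeval (fun i => φ (X i)) = φ := by
        ext i; simp
      rw [this, hφ]
      exact hp.1.2 (hI q hq)
    · by_contra hr
      push Not at hr
      choose c hc' using hr
      refine hc ⟨c, fun i => ?_⟩
      rw [← hφ, map_sub, ← MvPolynomial.algebraMap_eq, AlgHom.commutes, hc', sub_self]
  -- Each minimal prime is now concentrated at one point, so `S` lies in the finite set of these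
  -- points.
  choose! c hc using key
  refine hS (((I.finite_minimalPrimes_of_isNoetherianRing).image c).subset ?_)
  intro s hs
  have hle : I ≤ RingHom.ker (eval s) := iInf₂_le s hs
  have : (RingHom.ker (eval s)).IsPrime := RingHom.ker_isPrime _
  obtain ⟨p, hp, hps⟩ := Ideal.exists_minimalPrimes_le hle
  refine ⟨p, hp, funext fun i => ?_⟩
  have := hps (hc p hp i)
  rw [RingHom.mem_ker] at this
  simpa [sub_eq_zero, eq_comm] using this

/-- A transcendental element vanishes at some place of the field. -/
theorem exists_valuationSubring_lt_one {K : Type*} [Field K] [Algebra ℂ K] {t : K}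
    (ht : t ∉ Set.range (algebraMap ℂ K)) :
    ∃ B : ValuationSubring K, (∀ c, algebraMap ℂ K c ∈ B) ∧ B.valuation t < 1 := by
  let A : Subring K := (Algebra.adjoin ℂ {t}).toSubring
  have htA : t ∈ A := Algebra.self_mem_adjoin_singleton ℂ t
  have hI : Ideal.span {(⟨t, htA⟩ : A)} ≠ ⊤ := by
    intro h
    rw [Ideal.span_singleton_eq_top, isUnit_iff_exists_inv'] at h
    obtain ⟨⟨a, ha⟩, h⟩ := h
    obtain ⟨p, hp⟩ : ∃ p : Polynomial ℂ, Polynomial.aeval t p = a := by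
      have : a ∈ (Polynomial.aeval (R := ℂ) t).range := by
        rw [← Algebra.adjoin_singleton_eq_range_aeval]; exact ha
      exact this
    have h1 : a * t = 1 := congrArg Subtype.val h
    -- An inverse of `t` in `ℂ[t]` would make `t` algebraic, hence constant.
    have halg : IsAlgebraic ℂ t := by
      refine ⟨p * Polynomial.X - 1, fun h0 => ?_, by simp [hp, h1]⟩
      have := congrArg (Polynomial.eval 0) h0
      simp at this
    have hint := halg.isIntegral
    refine ht (minpoly.mem_range_of_degree_eq_one ℂ t ?_)
    exact IsAlgClosed.degree_eq_one_of_irreducible ℂ (minpoly.irreducible hint)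
  obtain ⟨B, hAB, hB⟩ := Ideal.image_subset_nonunits_valuationSubring _ hI
  refine ⟨B, fun c => hAB ((Algebra.adjoin ℂ {t}).algebraMap_mem c), ?_⟩
  exact (ValuationSubring.mem_nonunits_iff B).1
    (hB ⟨⟨t, htA⟩, Ideal.subset_span rfl, rfl⟩)

/-! ### Limits at a place -/

section Limits

variable {K : Type*} [Field K] (B : ValuationSubring K)

/-- `x` is finite at the place `B` and takes the value `r` there. -/
def HasLimit (x : K) (r : IsLocalRing.ResidueField B) : Prop :=
  ∃ h : x ∈ B, IsLocalRing.residue B ⟨x, h⟩ = r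

variable {B} {x y : K} {r s : IsLocalRing.ResidueField B}

theorem HasLimit.add (hx : HasLimit B x r) (hy : HasLimit B y s) : HasLimit B (x + y) (r + s) := by
  obtain ⟨hx, rfl⟩ := hx
  obtain ⟨hy, rfl⟩ := hy
  exact ⟨add_mem hx hy, map_add (IsLocalRing.residue B) ⟨x, hx⟩ ⟨y, hy⟩⟩

theorem HasLimit.sub (hx : HasLimit B x r) (hy : HasLimit B y s) : HasLimit B (x - y) (r - s) := by
  obtain ⟨hx, rfl⟩ := hx
  obtain ⟨hy, rfl⟩ := hy
  exact ⟨sub_mem hx hy, map_sub (IsLocalRing.residue B) ⟨x, hx⟩ ⟨y, hy⟩⟩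

theorem HasLimit.neg (hx : HasLimit B x r) : HasLimit B (-x) (-r) := by
  obtain ⟨hx, rfl⟩ := hx
  exact ⟨neg_mem hx, map_neg (IsLocalRing.residue B) ⟨x, hx⟩⟩

theorem HasLimit.mul (hx : HasLimit B x r) (hy : HasLimit B y s) : HasLimit B (x * y) (r * s) := by
  obtain ⟨hx, rfl⟩ := hx
  obtain ⟨hy, rfl⟩ := hy
  exact ⟨mul_mem hx hy, map_mul (IsLocalRing.residue B) ⟨x, hx⟩ ⟨y, hy⟩⟩

theorem HasLimit.unique (hx : HasLimit B x r) (hy : HasLimit B x s) : r = s := by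
  obtain ⟨hx, rfl⟩ := hx
  obtain ⟨hy, rfl⟩ := hy
  rfl

theorem hasLimit_one : HasLimit B (1 : K) 1 :=
  ⟨one_mem B, map_one (IsLocalRing.residue B)⟩

theorem hasLimit_zero_iff : HasLimit B x 0 ↔ B.valuation x < 1 := by
  constructor
  · rintro ⟨h, h0⟩
    rw [IsLocalRing.residue_eq_zero_iff, ValuationSubring.valuation_lt_one_iff] at h0
    exact h0
  · intro h
    refine ⟨(B.valuation_le_one_iff x).1 h.le, ?_⟩
    rw [IsLocalRing.residue_eq_zero_iff, ValuationSubring.valuation_lt_one_iff]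
    exact h

theorem exists_hasLimit (h : B.valuation x ≤ 1) : ∃ r, HasLimit B x r :=
  ⟨_, (B.valuation_le_one_iff x).1 h, rfl⟩

theorem exists_hasLimit_ne_zero (h : B.valuation x = 1) : ∃ r, HasLimit B x r ∧ r ≠ 0 := by
  obtain ⟨r, hr⟩ := exists_hasLimit h.le
  refine ⟨r, hr, ?_⟩
  rintro rfl
  exact (hasLimit_zero_iff.1 hr).ne h

theorem HasLimit.inv (hx : HasLimit B x r) (hr : r ≠ 0) : HasLimit B x⁻¹ r⁻¹ := by
  have h1 : B.valuation x = 1 := by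
    refine le_antisymm ((B.valuation_le_one_iff x).2 hx.1) (not_lt.1 fun h => hr ?_)
    exact hx.unique (hasLimit_zero_iff.2 h)
  have hx0 : x ≠ 0 := by rintro rfl; simp at h1
  obtain ⟨s, hs⟩ := exists_hasLimit (x := x⁻¹) (B := B) (by simp [h1])
  have := (hx.mul hs)
  rw [mul_inv_cancel₀ hx0] at this
  rw [inv_eq_of_mul_eq_one_right (this.unique hasLimit_one)]
  exact hs

theorem HasLimit.div (hx : HasLimit B x r) (hy : HasLimit B y s) (hs : s ≠ 0) :
    HasLimit B (x / y) (r / s) := by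
  rw [div_eq_mul_inv, div_eq_mul_inv]
  exact hx.mul (hy.inv hs)

theorem hasLimit_div_zero {x y : K} (h : B.valuation x < B.valuation y) :
    HasLimit B (x / y) 0 := by
  rw [hasLimit_zero_iff, map_div₀]
  exact (div_lt_one₀ (zero_le.trans_lt h)).2 h

end Limits

/-! ### Valuation estimates for velocities, and a strictly tightest pair -/

section

/-- Four indices in some order. -/
structure Distinct (i j k l : Fin 4) : Prop where
  ij : i ≠ j
  ik : i ≠ k
  il : i ≠ l
  jk : j ≠ k
  jl : j ≠ l
  kl : k ≠ l

namespace Distinct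

variable {i j k l : Fin 4}

theorem swap₁ (h : Distinct i j k l) : Distinct j i k l :=
  ⟨h.ij.symm, h.jk, h.jl, h.ik, h.il, h.kl⟩

theorem swap₂ (h : Distinct i j k l) : Distinct i k j l :=
  ⟨h.ik, h.ij, h.il, h.jk.symm, h.kl, h.jl⟩

theorem swap₃ (h : Distinct i j k l) : Distinct i j l k :=
  ⟨h.ij, h.il, h.ik, h.jl, h.jk, h.kl.symm⟩

theorem swapPairs (h : Distinct i j k l) : Distinct k l i j :=
  ⟨h.kl, h.ik.symm, h.jk.symm, h.il.symm, h.jl.symm, h.ij⟩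

theorem erase_eq (h : Distinct i j k l) : Finset.univ.erase i = {j, k, l} := by
  obtain ⟨h1, h2, h3, h4, h5, h6⟩ := h
  revert i j k l
  decide

theorem sum_erase {M : Type*} [AddCommMonoid M] (h : Distinct i j k l) (f : Fin 4 → M) :
    ∑ n ∈ Finset.univ.erase i, f n = f j + f k + f l := by
  rw [h.erase_eq, Finset.sum_insert (by simp [h.jk, h.jl]),
    Finset.sum_insert (by simp [h.kl]), Finset.sum_singleton, add_assoc]

end Distinct

variable {K : Type*} [Field K]

/-- `w` is the complexified velocity field of vortices of strengths `g` at the points `z`. -/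
structure IsField (g z w : Fin 4 → K) : Prop where
  inj : Function.Injective z
  eq : ∀ n, w n = ∑ j ∈ Finset.univ.erase n, g j / (z n - z j)

namespace IsField

variable {g z w : Fin 4 → K} {i j k l : Fin 4}

theorem ne_zero (h : IsField g z w) (hij : i ≠ j) : z i - z j ≠ 0 :=
  sub_ne_zero.2 fun e => hij (h.inj e)

theorem eq_add (h : IsField g z w) (hd : Distinct i j k l) :
    w i = g j / (z i - z j) + g k / (z i - z k) + g l / (z i - z l) := by
  rw [h.eq, hd.sum_erase]

/-- Outside vortices act on a relative velocity only by a tidal term, which carries the factor `z i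
- z j`. This matters when `g i + g j = 0` and the main term vanishes. -/
theorem sub_eq (h : IsField g z w) (hd : Distinct i j k l) :
    w i - w j = (g i + g j) / (z i - z j) - (z i - z j) *
      (g k / ((z i - z k) * (z j - z k)) + g l / ((z i - z l) * (z j - z l))) := by
  have h1 := h.ne_zero hd.ij
  have h2 := h.ne_zero hd.ik
  have h3 := h.ne_zero hd.il
  have h4 := h.ne_zero hd.jk
  have h5 := h.ne_zero hd.jl
  have h6 := h.ne_zero hd.ij.symm
  rw [h.eq_add hd, h.eq_add hd.swap₁,
    show g i / (z j - z i) = - (g i / (z i - z j)) by rw [← neg_sub, div_neg]]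
  field_simp
  ring

section Valued

variable {Γ₀ : Type*} [LinearOrderedCommGroupWithZero Γ₀] {v : Valuation K Γ₀}

theorem pos (h : IsField g z w) (v : Valuation K Γ₀) (hij : i ≠ j) : 0 < v (z i - z j) :=
  zero_lt_iff.2 ((Valuation.ne_zero_iff v).2 (h.ne_zero hij))

theorem map_div_le {q : Γ₀} (hq : 0 < q) {x y : K} (hx : v x = 1) (hy : q ≤ v y) :
    v (x / y) ≤ q⁻¹ := by
  rw [map_div₀, hx, one_div]
  exact inv_anti₀ hq hy

theorem le (h : IsField g z w) (hg : ∀ n, v (g n) = 1) (hd : Distinct i j k l) {q : Γ₀}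
    (hq : 0 < q) (hj : q ≤ v (z i - z j)) (hk : q ≤ v (z i - z k)) (hl : q ≤ v (z i - z l)) :
    v (w i) ≤ q⁻¹ := by
  rw [h.eq_add hd]
  exact v.map_add_le (v.map_add_le (map_div_le hq (hg _) hj) (map_div_le hq (hg _) hk))
    (map_div_le hq (hg _) hl)

theorem sub_div_le (h : IsField g z w) (hg : ∀ n, v (g n) = 1) (hd : Distinct i j k l) {q : Γ₀}
    (hq : 0 < q) (hk : q ≤ v (z i - z k)) (hl : q ≤ v (z i - z l)) :
    v (w i - g j / (z i - z j)) ≤ q⁻¹ := by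
  rw [h.eq_add hd, show ∀ a b c : K, a + b + c - a = b + c by intros; ring]
  exact v.map_add_le (map_div_le hq (hg _) hk) (map_div_le hq (hg _) hl)

theorem sub_sub_div_le (h : IsField g z w) (hg : ∀ n, v (g n) = 1) (hd : Distinct i j k l) {q : Γ₀}
    (hq : 0 < q) (hik : q ≤ v (z i - z k)) (hil : q ≤ v (z i - z l)) (hjk : q ≤ v (z j - z k))
    (hjl : q ≤ v (z j - z l)) :
    v (w i - w j - (g i + g j) / (z i - z j)) ≤ v (z i - z j) * (q * q)⁻¹ := by
  rw [h.sub_eq hd, show ∀ a b : K, a - b - a = -b by intros; ring, Valuation.map_neg, map_mul]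
  gcongr
  refine v.map_add_le (map_div_le (mul_pos hq hq) (hg _) ?_)
    (map_div_le (mul_pos hq hq) (hg _) ?_)
  all_goals rw [map_mul]; gcongr

end Valued

end IsField

/-- The system `u = F(z)`, `c z = F(u)`, where `F` is the velocity field. -/
structure IsDualPair (g : Fin 4 → K) (c : K) (z u : Fin 4 → K) : Prop where
  left : IsField g z u
  right : IsField g u fun n => c * z n

/-- The strengths and the multiplier are units of a valuation, and no unexpected cancellation takes
place between them. -/
structure IsUnitData {Γ₀ : Type*} [LinearOrderedCommGroupWithZero Γ₀] (v : Valuation K Γ₀)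
    (g : Fin 4 → K) (c : K) : Prop where
  mult : v c = 1
  single : ∀ n, v (g n) = 1
  pair : ∀ i j, g i + g j = 0 ∨ v (g i + g j) = 1
  two_pairs : ∀ {i j k l}, Distinct i j k l → ¬ (g i + g j = 0 ∧ g k + g l = 0)
  triple : ∀ {i j k l}, Distinct i j k l → v (g i + g j + g k) = 1
  triple_momentum : ∀ {i j k l}, Distinct i j k l → v (g i * g j + g i * g k + g j * g k) = 1

section Ultrametric

variable {Γ₀ : Type*} [LinearOrderedCommGroupWithZero Γ₀] (v : Valuation K Γ₀) (z : Fin 4 → K)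

theorem map_sub_symm (i j : Fin 4) : v (z i - z j) = v (z j - z i) := Valuation.map_sub_swap v _ _

theorem map_sub_tri (i j k : Fin 4) :
    v (z i - z k) ≤ v (z i - z j) ∨ v (z i - z k) ≤ v (z j - z k) := by
  have := v.map_add' (z i - z j) (z j - z k)
  rwa [sub_add_sub_cancel] at this

end Ultrametric

namespace IsDualPair

variable {g : Fin 4 → K} {c : K} {z u : Fin 4 → K} {i j k l : Fin 4}
variable {Γ₀ : Type*} [LinearOrderedCommGroupWithZero Γ₀] {v : Valuation K Γ₀}

theorem map_mult (hU : IsUnitData v g c) (x : K) : v (c * x) = v x := by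
  rw [map_mul, hU.mult, one_mul]

/-- A pair of opposite vortices cannot be isolated in both configurations. -/
theorem false_of_opposite (h : IsDualPair g c z u) (hU : IsUnitData v g c)
    (hd : Distinct i j k l) (h0 : g i + g j = 0) {p q : Γ₀} (hp : 0 < p) (hq : 0 < q)
    (hpq : 1 < p * q)
    (hik : p ≤ v (z i - z k)) (hil : p ≤ v (z i - z l)) (hjk : p ≤ v (z j - z k))
    (hjl : p ≤ v (z j - z l))
    (hik' : q ≤ v (u i - u k)) (hil' : q ≤ v (u i - u l)) (hjk' : q ≤ v (u j - u k))
    (hjl' : q ≤ v (u j - u l)) : False := by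
  have h1 := h.left.sub_sub_div_le hU.single hd hp hik hil hjk hjl
  have h2 := h.right.sub_sub_div_le hU.single hd hq hik' hil' hjk' hjl'
  simp only [h0, zero_div, sub_zero, ← mul_sub, map_mult hU] at h1 h2
  have hz := h.left.pos v hd.ij
  -- With the main terms gone, passing to `u` and back multiplies the separation by at most `(p *
  -- q)⁻² < 1`.
  have h3 : v (z i - z j) ≤ v (z i - z j) * ((p * q) * (p * q))⁻¹ := by
    calc _ ≤ v (u i - u j) * (q * q)⁻¹ := h2
      _ ≤ v (z i - z j) * (p * p)⁻¹ * (q * q)⁻¹ := by gcongr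
      _ = _ := by simp only [mul_inv]; ac_rfl
  have h4 : ((p * q) * (p * q))⁻¹ < 1 := inv_lt_one_of_one_lt₀ (one_lt_mul'' hpq hpq)
  exact absurd h3 (not_le.2 (mul_lt_of_lt_one_right hz h4))

/-- If two vortices are closer to each other than any other pair, then the remaining distances
have a common order. -/
theorem strict_min (h : IsDualPair g c z u) (hU : IsUnitData v g c)
    (hd : Distinct i j k l)
    (sik : v (z i - z j) < v (z i - z k)) (sil : v (z i - z j) < v (z i - z l))
    (sjk : v (z i - z j) < v (z j - z k)) (sjl : v (z i - z j) < v (z j - z l))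
    (skl : v (z i - z j) < v (z k - z l)) :
    g i + g j ≠ 0 ∧ g k + g l ≠ 0 ∧ v (z i) < v (z k - z l) ∧ v (z j) < v (z k - z l) ∧
    v (z i - z k) = v (z k - z l) ∧ v (z i - z l) = v (z k - z l) ∧
    v (z j - z k) = v (z k - z l) ∧ v (z j - z l) = v (z k - z l) ∧
    v (u k - u l) = (v (z k - z l))⁻¹ ∧ v (c * z k - g l / (u k - u l)) < v (z k - z l) ∧
    v (c * z l - g k / (u l - u k)) < v (z k - z l) := by
  have ha := h.left.pos v hd.ij
  -- `p` is the smallest of the other five distances.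
  obtain ⟨p, hp, hpa, hik, hil, hjk, hjl, hkl⟩ : ∃ p, 0 < p ∧ v (z i - z j) < p ∧
      p ≤ v (z i - z k) ∧ p ≤ v (z i - z l) ∧ p ≤ v (z j - z k) ∧ p ≤ v (z j - z l) ∧
      p ≤ v (z k - z l) := by
    refine ⟨v (z i - z k) ⊓ v (z i - z l) ⊓ (v (z j - z k) ⊓ v (z j - z l)) ⊓ v (z k - z l),
      ?_, ?_, ?_, ?_, ?_, ?_, ?_⟩
    · simp only [lt_inf_iff]
      exact ⟨⟨⟨ha.trans sik, ha.trans sil⟩, ha.trans sjk, ha.trans sjl⟩, ha.trans skl⟩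
    · simp only [lt_inf_iff]
      exact ⟨⟨⟨sik, sil⟩, sjk, sjl⟩, skl⟩
    all_goals simp
  set a := v (z i - z j) with ha_def
  have hpa' : p⁻¹ < a⁻¹ := inv_strictAnti₀ ha hpa
  have hdiv : ∀ m, v (g m / (z i - z j)) = a⁻¹ := fun m => by
    rw [map_div₀, hU.single, one_div]
  have hdiv' : ∀ m, v (g m / (z j - z i)) = a⁻¹ := fun m => by
    rw [map_div₀, hU.single, one_div, Valuation.map_sub_swap]
  have hui : v (u i) = a⁻¹ := by
    rw [← hdiv j]
    refine Valuation.map_eq_of_sub_lt v ?_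
    rw [hdiv]
    exact (h.left.sub_div_le hU.single hd hp hik hil).trans_lt hpa'
  have huj : v (u j) = a⁻¹ := by
    rw [← hdiv' i]
    refine Valuation.map_eq_of_sub_lt v ?_
    rw [hdiv']
    exact (h.left.sub_div_le hU.single hd.swap₁ hp hjk hjl).trans_lt hpa'
  have huk : v (u k) < a⁻¹ := by
    refine (h.left.le hU.single hd.swapPairs hp hkl ?_ ?_).trans_lt hpa'
    · rwa [map_sub_symm]
    · rwa [map_sub_symm]
  have hul : v (u l) < a⁻¹ := by
    refine (h.left.le hU.single hd.swapPairs.swap₁ hp ?_ ?_ ?_).trans_lt hpa'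
    · rwa [map_sub_symm]
    · rwa [map_sub_symm]
    · rwa [map_sub_symm]
  have hik' : v (u i - u k) = a⁻¹ := by
    rw [Valuation.map_sub_eq_of_lt_left v (by rwa [hui]), hui]
  have hil' : v (u i - u l) = a⁻¹ := by
    rw [Valuation.map_sub_eq_of_lt_left v (by rwa [hui]), hui]
  have hjk' : v (u j - u k) = a⁻¹ := by
    rw [Valuation.map_sub_eq_of_lt_left v (by rwa [huj]), huj]
  have hjl' : v (u j - u l) = a⁻¹ := by
    rw [Valuation.map_sub_eq_of_lt_left v (by rwa [huj]), huj]
  have ha' : 0 < a⁻¹ := inv_pos.2 ha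
  have hpa1 : 1 < p * a⁻¹ := by
    rwa [← div_eq_mul_inv, one_lt_div₀ ha]
  have hij0 : g i + g j ≠ 0 := fun h0 =>
    h.false_of_opposite hU hd h0 hp ha' hpa1 hik hil hjk hjl hik'.ge hil'.ge hjk'.ge hjl'.ge
  have hij1 := (hU.pair i j).resolve_left hij0
  have hij' : v (u i - u j) = a⁻¹ := by
    have : v ((g i + g j) / (z i - z j)) = a⁻¹ := by rw [map_div₀, hij1, one_div]
    rw [← this]
    refine Valuation.map_eq_of_sub_lt v ?_
    rw [this]
    refine (h.left.sub_sub_div_le hU.single hd hp hik hil hjk hjl).trans_lt ?_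
    have : a * (p * p)⁻¹ < a * (a * a)⁻¹ := by
      refine mul_lt_mul_of_pos_left ?_ ha
      exact inv_strictAnti₀ (mul_pos ha ha) (mul_lt_mul'' hpa hpa ha.le ha.le)
    rwa [mul_inv a a, mul_inv_cancel_left₀ ha.ne'] at this
  -- Now the second half of the system is used: `i` and `j` are isolated in `u`, so their positions
  -- are small, while `z k` and `z l` are governed by the interaction of `k` with `l`.
  have hzi : v (z i) ≤ a := by
    have := h.right.le hU.single hd ha' hij'.ge hik'.ge hil'.ge
    rwa [map_mult hU, inv_inv] at this
  have hzj : v (z j) ≤ a := by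
    have := h.right.le hU.single hd.swap₁ ha' (by rw [map_sub_symm, hij']) hjk'.ge hjl'.ge
    rwa [map_mult hU, inv_inv] at this
  have hzk := h.right.sub_div_le hU.single hd.swapPairs ha' (by rw [map_sub_symm, hik'])
    (by rw [map_sub_symm, hjk'])
  have hzl := h.right.sub_div_le hU.single hd.swapPairs.swap₁ ha' (by rw [map_sub_symm, hil'])
    (by rw [map_sub_symm, hjl'])
  rw [inv_inv] at hzk hzl
  have vzk : v (z i - z k) = v (z k) ∧ v (z j - z k) = v (z k) ∧ a < v (z k) := by
    have : a < v (z k) := by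
      by_contra hcon
      exact (hpa.trans_le hik).not_ge (v.map_sub_le hzi (not_lt.1 hcon))
    exact ⟨Valuation.map_sub_eq_of_lt_right v (hzi.trans_lt this),
      Valuation.map_sub_eq_of_lt_right v (hzj.trans_lt this), this⟩
  have vzl : v (z i - z l) = v (z l) ∧ v (z j - z l) = v (z l) ∧ a < v (z l) := by
    have : a < v (z l) := by
      by_contra hcon
      exact (hpa.trans_le hil).not_ge (v.map_sub_le hzi (not_lt.1 hcon))
    exact ⟨Valuation.map_sub_eq_of_lt_right v (hzi.trans_lt this),
      Valuation.map_sub_eq_of_lt_right v (hzj.trans_lt this), this⟩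
  have huk : (v (u k - u l))⁻¹ = v (z k) := by
    rw [← map_mult hU (z k), ← one_div, ← hU.single l, ← map_div₀]
    refine Valuation.map_eq_of_sub_lt v ?_
    rw [Valuation.map_sub_swap, map_mult hU]
    exact hzk.trans_lt vzk.2.2
  have hul : (v (u k - u l))⁻¹ = v (z l) := by
    rw [map_sub_symm, ← map_mult hU (z l), ← one_div, ← hU.single k, ← map_div₀]
    refine Valuation.map_eq_of_sub_lt v ?_
    rw [Valuation.map_sub_swap, map_mult hU]
    exact hzl.trans_lt vzl.2.2
  have hkl0 : g k + g l ≠ 0 := by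
    intro h0
    refine h.false_of_opposite hU hd.swapPairs h0 (ha.trans vzk.2.2) ha' ?_ ?_ ?_ ?_ ?_
      (by rw [map_sub_symm, hik']) (by rw [map_sub_symm, hjk']) (by rw [map_sub_symm, hil'])
      (by rw [map_sub_symm, hjl'])
    · rw [← div_eq_mul_inv, one_lt_div₀ ha]; exact vzk.2.2
    · rw [map_sub_symm, vzk.1]
    · rw [map_sub_symm, vzk.2.1]
    · rw [map_sub_symm, vzl.1, ← huk, hul]
    · rw [map_sub_symm, vzl.2.1, ← huk, hul]
  have hkl1 := (hU.pair k l).resolve_left hkl0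
  have hzkl : v (z k - z l) = v (z k) := by
    rw [← huk, ← one_div, ← hkl1, ← map_div₀, ← map_mult hU]
    refine Valuation.map_eq_of_sub_lt v ?_
    have e : c * (z k - z l) - (g k + g l) / (u k - u l) =
        (c * z k - g l / (u k - u l)) - (c * z l - g k / (u l - u k)) := by
      rw [← neg_sub (u k) (u l), div_neg]; ring
    rw [e, map_div₀, hkl1, one_div, huk]
    exact (v.map_sub_le hzk hzl).trans_lt vzk.2.2
  have hlk : v (z l) = v (z k) := by rw [← huk, hul]
  refine ⟨hij0, hkl0, ?_, ?_, ?_, ?_, ?_, ?_, ?_, ?_, ?_⟩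
  · rw [hzkl]; exact hzi.trans_lt vzk.2.2
  · rw [hzkl]; exact hzj.trans_lt vzk.2.2
  · rw [hzkl, vzk.1]
  · rw [hzkl, vzl.1, hlk]
  · rw [hzkl, vzk.2.1]
  · rw [hzkl, vzl.2.1, hlk]
  · rw [hzkl, ← huk, inv_inv]
  · rw [hzkl]; exact hzk.trans_lt vzk.2.2
  · rw [hzkl]; exact hzl.trans_lt vzk.2.2

end IsDualPair

end

/-! ### Clusters: two tight pairs, and triples -/

section

variable {K : Type*} [Field K]

namespace IsDualPair

variable {g : Fin 4 → K} {c : K} {z u : Fin 4 → K} {i j k l : Fin 4}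
variable {Γ₀ : Type*} [LinearOrderedCommGroupWithZero Γ₀] {v : Valuation K Γ₀}

theorem map_le_of_isolated (h : IsDualPair g c z u) (hU : IsUnitData v g c)
    (hd : Distinct i j k l) {a : Γ₀} (ha : 0 < a) (hj : a⁻¹ ≤ v (u i - u j))
    (hk : a⁻¹ ≤ v (u i - u k)) (hl : a⁻¹ ≤ v (u i - u l)) : v (z i) ≤ a := by
  have := h.right.le hU.single hd (inv_pos.2 ha) hj hk hl
  rwa [map_mult hU, inv_inv] at this

theorem map_sub_div_le (h : IsDualPair g c z u) (hU : IsUnitData v g c)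
    (hd : Distinct i j k l) {a : Γ₀} (ha : 0 < a)
    (hk : a⁻¹ ≤ v (u i - u k)) (hl : a⁻¹ ≤ v (u i - u l)) :
    v (c * z i - g j / (u i - u j)) ≤ a := by
  have := h.right.sub_div_le hU.single hd (inv_pos.2 ha) hk hl
  rwa [inv_inv] at this

theorem lt_of_lt_of_lt {w : Fin 4 → K} {q : Γ₀} (hij : v (w i - w j) < q)
    (hjk : v (w j - w k) < q) : v (w i - w k) < q := by
  have := v.map_add_lt hij hjk
  rwa [sub_add_sub_cancel] at this

/-- Two equally tight pairs, at a larger distance from each other. -/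
structure TwoPairs (v : Valuation K Γ₀) (z : Fin 4 → K) (i j k l : Fin 4) (a m : Γ₀) : Prop where
  distinct : Distinct i j k l
  pos : 0 < a
  lt : a < m
  ij : v (z i - z j) = a
  kl : v (z k - z l) = a
  ik : v (z i - z k) = m
  il : v (z i - z l) = m
  jk : v (z j - z k) = m
  jl : v (z j - z l) = m

namespace TwoPairs

variable {a m : Γ₀}

theorem swap₁ (t : TwoPairs v z i j k l a m) : TwoPairs v z j i k l a m :=
  ⟨t.distinct.swap₁, t.pos, t.lt, by rw [map_sub_symm, t.ij], t.kl, t.jk, t.jl, t.ik, t.il⟩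

theorem swap₃ (t : TwoPairs v z i j k l a m) : TwoPairs v z i j l k a m :=
  ⟨t.distinct.swap₃, t.pos, t.lt, t.ij, by rw [map_sub_symm, t.kl], t.il, t.ik, t.jl, t.jk⟩

theorem swapPairs (t : TwoPairs v z i j k l a m) : TwoPairs v z k l i j a m :=
  ⟨t.distinct.swapPairs, t.pos, t.lt, t.kl, t.ij, by rw [map_sub_symm, t.ik],
    by rw [map_sub_symm, t.jk], by rw [map_sub_symm, t.il], by rw [map_sub_symm, t.jl]⟩

theorem inv_lt (t : TwoPairs v z i j k l a m) : m⁻¹ < a⁻¹ := inv_strictAnti₀ t.pos t.lt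

theorem mul_lt (t : TwoPairs v z i j k l a m) : a * (m * m)⁻¹ < m⁻¹ := by
  have hm := t.pos.trans t.lt
  rw [mul_inv, ← mul_assoc]
  refine mul_lt_of_lt_one_left (inv_pos.2 hm) ?_
  rw [← div_eq_mul_inv]
  exact (div_lt_one₀ hm).2 t.lt

theorem sub_sub_div_le (t : TwoPairs v z i j k l a m) (h : IsDualPair g c z u)
    (hU : IsUnitData v g c) :
    v (u i - u j - (g i + g j) / (z i - z j)) ≤ a * (m * m)⁻¹ := by
  have := h.left.sub_sub_div_le hU.single t.distinct (t.pos.trans t.lt) t.ik.ge t.il.ge t.jk.ge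
    t.jl.ge
  rwa [t.ij] at this

theorem map_sub_of_ne_zero (t : TwoPairs v z i j k l a m) (h : IsDualPair g c z u)
    (hU : IsUnitData v g c) (h0 : g i + g j ≠ 0) : v (u i - u j) = a⁻¹ := by
  have : v ((g i + g j) / (z i - z j)) = a⁻¹ := by
    rw [map_div₀, (hU.pair i j).resolve_left h0, t.ij, one_div]
  rw [← this]
  refine Valuation.map_eq_of_sub_lt v ?_
  rw [this]
  exact ((t.sub_sub_div_le h hU).trans_lt t.mul_lt).trans t.inv_lt

theorem map_eq (t : TwoPairs v z i j k l a m) (h : IsDualPair g c z u)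
    (hU : IsUnitData v g c) : v (u i) = a⁻¹ := by
  have : v (g j / (z i - z j)) = a⁻¹ := by rw [map_div₀, hU.single, t.ij, one_div]
  rw [← this]
  refine Valuation.map_eq_of_sub_lt v ?_
  rw [this]
  exact (h.left.sub_div_le hU.single t.distinct (t.pos.trans t.lt) t.ik.ge t.il.ge).trans_lt
    t.inv_lt

theorem map_sub_le (t : TwoPairs v z i j k l a m) (h : IsDualPair g c z u)
    (hU : IsUnitData v g c) : v (u i - u j) ≤ a⁻¹ :=
  v.map_sub_le (t.map_eq h hU).le (t.swap₁.map_eq h hU).le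

/-- Put `d = v (u i - u j)`, so `d⁻¹ > m`. Since `z l` is small, `z i` and `z j` have order `m`, too
small to balance the interaction of order `d⁻¹`; hence `u k` must lie at distance `d` from both `u
i` and `u j`. The tidal formula then gives `a = v (z i - z j) = d⁻¹ > m`, which is absurd. -/
theorem false_of_opposite_of_lt (t : TwoPairs v z i j k l a m) (h : IsDualPair g c z u)
    (hU : IsUnitData v g c) (h0 : g i + g j = 0) (hik : v (u i - u k) < a⁻¹) : False := by
  have hd := t.distinct
  have hkl0 : g k + g l ≠ 0 := fun e => hU.two_pairs hd ⟨h0, e⟩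
  have hkl := t.swapPairs.map_sub_of_ne_zero h hU hkl0
  have hij : v (u i - u j) ≤ a * (m * m)⁻¹ := by
    simpa [h0] using t.sub_sub_div_le h hU
  have hij' : v (u i - u j) < m⁻¹ := hij.trans_lt t.mul_lt
  have hij'' := hij'.trans t.inv_lt
  have hm := t.pos.trans t.lt
  have hjk : v (u j - u k) < a⁻¹ := lt_of_lt_of_lt (by rwa [map_sub_symm]) hik
  have hil : a⁻¹ ≤ v (u i - u l) := by
    by_contra hcon
    exact (lt_of_lt_of_lt (by rwa [map_sub_symm]) (not_le.1 hcon)).ne hkl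
  have hjl : a⁻¹ ≤ v (u j - u l) := by
    by_contra hcon
    exact (lt_of_lt_of_lt (by rwa [map_sub_symm]) (not_le.1 hcon)).ne hkl
  have hzl : v (z l) ≤ a := h.map_le_of_isolated hU hd.swapPairs.swap₁ t.pos
    (by rw [map_sub_symm, hkl]) (by rwa [map_sub_symm]) (by rwa [map_sub_symm])
  have key : ∀ {i j : Fin 4}, Distinct i j k l → v (u i - u j) < m⁻¹ → a⁻¹ ≤ v (u i - u l) →
      v (z i - z l) = m → v (u i - u k) = v (u i - u j) := by
    intro i j hd hij hil hzil
    have hpos := h.right.pos v hd.ij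
    have hzi : v (z i) = m := by
      rw [← hzil]
      refine Valuation.map_eq_of_sub_lt v ?_
      rw [sub_sub_cancel, hzil]
      exact hzl.trans_lt t.lt
    have hlt : m < v (g j / (u i - u j)) := by
      rw [map_div₀, hU.single, one_div]
      exact (lt_inv_comm₀ hm hpos).2 hij
    have e : g k / (u i - u k) = (c * z i - g l / (u i - u l)) - g j / (u i - u j) := by
      rw [h.right.eq_add hd]; ring
    have hl : v (g l / (u i - u l)) ≤ a := by
      have := IsField.map_div_le (inv_pos.2 t.pos) (hU.single l) hil
      rwa [inv_inv] at this
    have := congrArg v e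
    rw [Valuation.map_sub_eq_of_lt_right v, map_div₀, map_div₀, hU.single, hU.single, one_div,
      one_div] at this
    · exact inv_injective this
    · refine lt_of_le_of_lt (v.map_sub_le ?_ (hl.trans t.lt.le)) hlt
      rw [map_mult hU, hzi]
  have e1 := key hd hij' hil t.il
  have e2 := key hd.swap₁ (by rwa [map_sub_symm]) hjl t.jl
  rw [map_sub_symm v u j i] at e2
  set d := v (u i - u j) with hd_def
  have hdpos : 0 < d := h.right.pos v hd.ij
  have hmd : m < d⁻¹ := (lt_inv_comm₀ hm hdpos).2 hij'
  have e3 := congrArg v (h.right.sub_eq hd)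
  have e4 : v (g k / ((u i - u k) * (u j - u k))) = d⁻¹ * d⁻¹ := by
    rw [map_div₀, map_mul, e1, e2, hU.single, one_div, mul_inv]
  have e5 : v (g l / ((u i - u l) * (u j - u l))) ≤ a * a := by
    rw [map_div₀, map_mul, hU.single, one_div, mul_inv]
    gcongr
    · exact inv_le_of_inv_le₀ t.pos hil
    · exact inv_le_of_inv_le₀ t.pos hjl
  have hlt : a < d⁻¹ := t.lt.trans hmd
  have e6 : v (g k / ((u i - u k) * (u j - u k)) + g l / ((u i - u l) * (u j - u l))) =
      d⁻¹ * d⁻¹ := by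
    rw [Valuation.map_add_eq_of_lt_left, e4]
    rw [e4]
    exact e5.trans_lt (mul_lt_mul'' hlt hlt t.pos.le t.pos.le)
  rw [h0, zero_div, zero_sub, Valuation.map_neg, map_mul v (u i - u j), e6, ← mul_sub, map_mult hU,
    t.ij, ← hd_def, mul_inv_cancel_left₀ hdpos.ne'] at e3
  exact hlt.ne e3

theorem false_of_opposite (t : TwoPairs v z i j k l a m) (h : IsDualPair g c z u)
    (hU : IsUnitData v g c) (h0 : g i + g j = 0) : False := by
  have hm := t.pos.trans t.lt
  refine h.false_of_opposite hU t.distinct h0 hm (inv_pos.2 t.pos) ?_ t.ik.ge t.il.ge t.jk.ge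
    t.jl.ge ?_ ?_ ?_ ?_
  · rw [← div_eq_mul_inv, one_lt_div₀ t.pos]; exact t.lt
  all_goals refine not_lt.1 fun hlt => ?_
  · exact t.false_of_opposite_of_lt h hU h0 hlt
  · exact t.swap₃.false_of_opposite_of_lt h hU h0 hlt
  · exact t.swap₁.false_of_opposite_of_lt h hU (by rwa [add_comm]) hlt
  · exact t.swap₁.swap₃.false_of_opposite_of_lt h hU (by rwa [add_comm]) hlt

/-- A vortex isolated in `u` has position at most `a`. If `i` is isolated, neither `k` nor `l` can
be, as both are at distance `m > a` from `i`; both would then be close to `j` in `u`, hence to each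
other, against `v (u k - u l) = a⁻¹`. -/
theorem not_isolated (t : TwoPairs v z i j k l a m) (h : IsDualPair g c z u)
    (hU : IsUnitData v g c) : v (u i - u k) < a⁻¹ ∨ v (u i - u l) < a⁻¹ := by
  have hd := t.distinct
  have hij := t.map_sub_of_ne_zero h hU (t.false_of_opposite h hU)
  have hkl := t.swapPairs.map_sub_of_ne_zero h hU (t.swapPairs.false_of_opposite h hU)
  by_contra! hcon
  have hzi : v (z i) ≤ a := h.map_le_of_isolated hU hd t.pos hij.ge hcon.1 hcon.2
  have hjk : v (u k - u j) < a⁻¹ := by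
    by_contra hc
    have := h.map_le_of_isolated hU hd.swapPairs t.pos hkl.ge
      (by rw [map_sub_symm]; exact hcon.1) (not_lt.1 hc)
    exact t.lt.not_ge (t.ik.symm.trans_le (v.map_sub_le hzi this))
  have hjl : v (u l - u j) < a⁻¹ := by
    by_contra hc
    have := h.map_le_of_isolated hU hd.swapPairs.swap₁ t.pos (by rw [map_sub_symm, hkl])
      (by rw [map_sub_symm]; exact hcon.2) (not_lt.1 hc)
    exact t.lt.not_ge (t.il.symm.trans_le (v.map_sub_le hzi this))
  exact (lt_of_lt_of_lt hjk (by rwa [map_sub_symm])).ne hkl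

/-- Two tight pairs in one configuration are exchanged for two other ones in the other. -/
theorem crossed (t : TwoPairs v z i j k l a m) (h : IsDualPair g c z u)
    (hU : IsUnitData v g c) (hik : v (u i - u k) < a⁻¹) :
    v (u i - u k) = m⁻¹ ∧ v (c * z i - g k / (u i - u k)) ≤ a ∧
      v (c * z k - g i / (u k - u i)) ≤ a ∧ v (u j - u l) < a⁻¹ := by
  have hd := t.distinct
  have hij := t.map_sub_of_ne_zero h hU (t.false_of_opposite h hU)
  have hkl := t.swapPairs.map_sub_of_ne_zero h hU (t.swapPairs.false_of_opposite h hU)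
  have hil : a⁻¹ ≤ v (u i - u l) := by
    by_contra hcon
    exact (lt_of_lt_of_lt (by rwa [map_sub_symm]) (not_le.1 hcon)).ne hkl
  have hjk : a⁻¹ ≤ v (u k - u j) := by
    by_contra hcon
    exact (lt_of_lt_of_lt hik (not_le.1 hcon)).ne hij
  have hlj : v (u j - u l) < a⁻¹ := by
    refine (t.swap₁.not_isolated h hU).resolve_left ?_
    rw [map_sub_symm]; exact not_lt.2 hjk
  have h1 := h.map_sub_div_le hU hd.swap₂ t.pos hij.ge hil
  have h2 := h.map_sub_div_le hU hd.swap₂.swap₁ t.pos hjk hkl.ge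
  refine ⟨?_, h1, h2, hlj⟩
  have e : c * (z i - z k) - (g i + g k) / (u i - u k) =
      (c * z i - g k / (u i - u k)) - (c * z k - g i / (u k - u i)) := by
    rw [← neg_sub (u i) (u k), div_neg]; ring
  -- The left side of `e` is within order `a` of zero, while `z i - z k` has the larger order `m`;
  -- so the `i, k` interaction has order exactly `m`.
  have hlt : v ((g i + g k) / (u i - u k) - c * (z i - z k)) < v (c * (z i - z k)) := by
    rw [Valuation.map_sub_swap, e, map_mult hU, t.ik]
    exact (v.map_sub_le h1 h2).trans_lt t.lt
  have h3 := Valuation.map_eq_of_sub_lt v hlt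
  rw [map_mult hU, t.ik] at h3
  have hne : g i + g k ≠ 0 := by
    intro h0
    rw [h0, zero_div, map_zero] at h3
    exact (t.pos.trans t.lt).ne h3
  rw [map_div₀, (hU.pair i k).resolve_left hne, one_div] at h3
  rw [← h3, inv_inv]

end TwoPairs

/-- Three vortices at mutual distances of the same order, and a distant fourth one. -/
structure Triple (v : Valuation K Γ₀) (z : Fin 4 → K) (i j k l : Fin 4) (a m : Γ₀) : Prop where
  distinct : Distinct i j k l
  pos : 0 < a
  lt : a < m
  ij : v (z i - z j) = a
  ik : v (z i - z k) = a
  jk : v (z j - z k) = a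
  il : v (z i - z l) = m
  jl : v (z j - z l) = m
  kl : v (z k - z l) = m

namespace Triple

variable {a m : Γ₀}

theorem swap₁ (t : Triple v z i j k l a m) : Triple v z j i k l a m :=
  ⟨t.distinct.swap₁, t.pos, t.lt, by rw [map_sub_symm, t.ij], t.jk, t.ik, t.jl, t.il, t.kl⟩

theorem swap₂ (t : Triple v z i j k l a m) : Triple v z i k j l a m :=
  ⟨t.distinct.swap₂, t.pos, t.lt, t.ik, t.ij, by rw [map_sub_symm, t.jk], t.il, t.kl, t.jl⟩

theorem inv_lt (t : Triple v z i j k l a m) : m⁻¹ < a⁻¹ := inv_strictAnti₀ t.pos t.lt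

theorem map_far_lt (t : Triple v z i j k l a m) (h : IsDualPair g c z u)
    (hU : IsUnitData v g c) : v (u l) < a⁻¹ := by
  refine lt_of_le_of_lt ?_ t.inv_lt
  have hd : Distinct l i j k := t.distinct.swap₃.swap₂.swap₁
  exact h.left.le hU.single hd (t.pos.trans t.lt) (by rw [map_sub_symm, t.il])
    (by rw [map_sub_symm, t.jl]) (by rw [map_sub_symm, t.kl])

theorem map_div_far_lt (t : Triple v z i j k l a m) (hU : IsUnitData v g c) :
    v (g l / (z i - z l)) < a⁻¹ := by
  rw [map_div₀, hU.single, t.il, one_div]; exact t.inv_lt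

theorem map_le (t : Triple v z i j k l a m) (h : IsDualPair g c z u)
    (hU : IsUnitData v g c) : v (u i) ≤ a⁻¹ :=
  h.left.le hU.single t.distinct t.pos t.ij.ge t.ik.ge (t.lt.le.trans t.il.ge)

/-- The velocities in the triple satisfy the equations of the three-vortex problem. -/
theorem exists_velocity (t : Triple v z i j k l a m) (h : IsDualPair g c z u)
    (hU : IsUnitData v g c) : ∃ f₁ f₂ f₃ : K, v (u i - f₁) < a⁻¹ ∧ v (u j - f₂) < a⁻¹ ∧
      v (u k - f₃) < a⁻¹ ∧ g i * f₁ + g j * f₂ + g k * f₃ = 0 ∧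
      g j * (z j - z i) * f₂ + g k * (z k - z i) * f₃ = g i * g j + g i * g k + g j * g k := by
  have hd := t.distinct
  have h1 := h.left.ne_zero hd.ij
  have h2 := h.left.ne_zero hd.ik
  have h3 := h.left.ne_zero hd.jk
  refine ⟨g j / (z i - z j) + g k / (z i - z k), - (g i / (z i - z j)) + g k / (z j - z k),
    - (g i / (z i - z k)) - g j / (z j - z k), ?_, ?_, ?_, ?_, ?_⟩
  · rw [h.left.eq_add hd, add_sub_cancel_left]
    exact t.map_div_far_lt hU
  · rw [h.left.eq_add hd.swap₁, ← neg_sub (z i) (z j), div_neg, add_sub_cancel_left]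
    exact t.swap₁.map_div_far_lt hU
  · rw [h.left.eq_add hd.swap₂.swap₁.swap₂, ← neg_sub (z i) (z k), ← neg_sub (z j) (z k), div_neg,
      div_neg, ← sub_eq_add_neg, neg_sub_comm, add_sub_cancel_left]
    exact t.swap₂.swap₁.map_div_far_lt hU
  · field_simp
    ring
  · field_simp
    ring

/-- Two slow vortices would make the moment identity of the three-vortex problem less than 1, but
its right side, the angular momentum of the triple, is a unit. -/
theorem not_two_slow (t : Triple v z i j k l a m) (h : IsDualPair g c z u)
    (hU : IsUnitData v g c) (hj : v (u j) < a⁻¹) : v (u k) = a⁻¹ := by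
  refine le_antisymm (t.swap₂.swap₁.map_le h hU) (not_lt.1 fun hk => ?_)
  obtain ⟨f₁, f₂, f₃, -, h2, h3, -, hL⟩ := t.exists_velocity h hU
  have hf₂ : v f₂ < a⁻¹ := by
    have := v.map_sub_lt hj h2
    rwa [sub_sub_cancel] at this
  have hf₃ : v f₃ < a⁻¹ := by
    have := v.map_sub_lt hk h3
    rwa [sub_sub_cancel] at this
  have hlt : ∀ n p q f, v (z p - z q) = a → v f < a⁻¹ → v (g n * (z p - z q) * f) < 1 := by
    intro n p q f hpq hf
    rw [map_mul, map_mul, hU.single, hpq, one_mul, ← mul_inv_cancel₀ t.pos.ne']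
    exact mul_lt_mul_of_pos_left hf t.pos
  have := v.map_add_lt (hlt j j i f₂ (by rw [map_sub_symm, t.ij]) hf₂)
    (hlt k k i f₃ (by rw [map_sub_symm, t.ik]) hf₃)
  rw [hL, hU.triple_momentum t.distinct] at this
  exact this.ne rfl

/-- If `u i` is slow, `u j` and `u k` have order `a⁻¹`. When these two are close, the center
identity forces `g j + g k = 0`, and the tidal formula puts them at distance exactly `a⁻¹`. When
they are not, `z j` and so `z i` are at most `a`; then the `i, l` interaction in `u`, hence also `z
l`, is at most `a`, against `v (z i - z l) = m`. -/
theorem not_slow (t : Triple v z i j k l a m) (h : IsDualPair g c z u)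
    (hU : IsUnitData v g c) : a⁻¹ ≤ v (u i) := by
  by_contra! hi
  have hd := t.distinct
  have hj := t.swap₂.swap₁.not_two_slow h hU hi
  have hk := t.swap₁.not_two_slow h hU hi
  have hl := t.map_far_lt h hU
  have hij : v (u i - u j) = a⁻¹ := by
    rw [Valuation.map_sub_eq_of_lt_right v (by rwa [hj]), hj]
  have hik : v (u i - u k) = a⁻¹ := by
    rw [Valuation.map_sub_eq_of_lt_right v (by rwa [hk]), hk]
  have hjl : v (u j - u l) = a⁻¹ := by
    rw [Valuation.map_sub_eq_of_lt_left v (by rwa [hj]), hj]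
  have hkl : v (u k - u l) = a⁻¹ := by
    rw [Valuation.map_sub_eq_of_lt_left v (by rwa [hk]), hk]
  have h1 := h.map_sub_div_le hU hd.swap₃.swap₂ t.pos hij.ge hik.ge
  have h2 := h.map_sub_div_le hU hd.swap₃.swap₂.swap₁ t.pos
    (by rw [map_sub_symm, hjl]) (by rw [map_sub_symm, hkl])
  by_cases hjk : v (u j - u k) < a⁻¹
  · obtain ⟨f₁, f₂, f₃, hf1, hf2, hf3, hM, -⟩ := t.exists_velocity h hU
    have hf₁ : v f₁ < a⁻¹ := by
      have := v.map_sub_lt hi hf1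
      rwa [sub_sub_cancel] at this
    have hf₂₃ : v (f₃ - f₂) < a⁻¹ := by
      have := v.map_sub_lt (v.map_sub_lt hf2 hf3) hjk
      rwa [show u j - f₂ - (u k - f₃) - (u j - u k) = f₃ - f₂ by ring] at this
    have hjk0 : g j + g k = 0 := by
      by_contra hne
      have e : (g j + g k) * f₂ = - (g i * f₁ + g k * (f₃ - f₂)) := by
        linear_combination hM
      have e1 := congrArg v e
      rw [map_mul, (hU.pair j k).resolve_left hne, one_mul, Valuation.map_neg] at e1
      have e2 : v (g i * f₁ + g k * (f₃ - f₂)) < a⁻¹ := by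
        refine v.map_add_lt ?_ ?_
        · rwa [map_mul, hU.single, one_mul]
        · rwa [map_mul, hU.single, one_mul]
      rw [← e1] at e2
      have := v.map_add_lt hf2 e2
      rw [sub_add_cancel, hj] at this
      exact this.ne rfl
    have e := congrArg v (h.left.sub_eq hd.swap₁.swap₂)
    have e4 : v (g i / ((z j - z i) * (z k - z i))) = a⁻¹ * a⁻¹ := by
      rw [map_div₀, map_mul, map_sub_symm v z j, map_sub_symm v z k, t.ij, t.ik, hU.single,
        one_div, mul_inv]
    have e5 : v (g l / ((z j - z l) * (z k - z l))) = m⁻¹ * m⁻¹ := by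
      rw [map_div₀, map_mul, t.jl, t.kl, hU.single, one_div, mul_inv]
    have hm' := inv_pos.2 (t.pos.trans t.lt)
    rw [hjk0, zero_div, zero_sub, Valuation.map_neg, map_mul,
      Valuation.map_add_eq_of_lt_left v, e4, t.jk, mul_inv_cancel_left₀ t.pos.ne'] at e
    · exact hjk.ne e
    · rw [e4, e5]
      exact mul_lt_mul'' t.inv_lt t.inv_lt hm'.le hm'.le
  · have hzj := h.map_le_of_isolated hU hd.swap₁ t.pos (by rw [map_sub_symm, hij])
      (not_lt.1 hjk) hjl.ge
    have hzi : v (z i) ≤ a := by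
      have := v.map_add_le hzj t.ij.le
      rwa [add_sub_cancel] at this
    have hdiv : v (g l / (u i - u l)) ≤ a := by
      have := v.map_sub_le ((map_mult hU _).trans_le hzi) h1
      rwa [sub_sub_cancel] at this
    have hzl : v (z l) ≤ a := by
      rw [← map_mult hU]
      have : v (g i / (u l - u i)) ≤ a := by
        rwa [map_div₀, hU.single, map_sub_symm, ← hU.single l, ← map_div₀]
      have := v.map_add_le h2 this
      rwa [sub_add_cancel] at this
    exact t.lt.not_ge (t.il.symm.trans_le (v.map_sub_le hzi hzl))

theorem map_eq (t : Triple v z i j k l a m) (h : IsDualPair g c z u)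
    (hU : IsUnitData v g c) : v (u i) = a⁻¹ := (t.map_le h hU).antisymm (t.not_slow h hU)

theorem map_sub_far (t : Triple v z i j k l a m) (h : IsDualPair g c z u)
    (hU : IsUnitData v g c) : v (u i - u l) = a⁻¹ := by
  rw [← t.map_eq h hU]
  exact Valuation.map_sub_eq_of_lt_left v ((t.map_far_lt h hU).trans_eq (t.map_eq h hU).symm)

/-- The far vortex is isolated in `u`, so `z l` is at most `a`; an isolated `i` would give the same
bound for `z i`, contradicting their distance `m`. -/
theorem not_isolated (t : Triple v z i j k l a m) (h : IsDualPair g c z u)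
    (hU : IsUnitData v g c) : v (u i - u j) < a⁻¹ ∨ v (u i - u k) < a⁻¹ := by
  by_contra! hcon
  have hd := t.distinct
  have hi := t.map_sub_far h hU
  have hj := t.swap₁.map_sub_far h hU
  have hk := t.swap₂.swap₁.map_sub_far h hU
  have hzi := h.map_le_of_isolated hU hd t.pos hcon.1 hcon.2 hi.ge
  have hzl := h.map_le_of_isolated hU hd.swap₃.swap₂.swap₁ t.pos (by rw [map_sub_symm, hi])
    (by rw [map_sub_symm, hj]) (by rw [map_sub_symm, hk])
  exact t.lt.not_ge (t.il.symm.trans_le (v.map_sub_le hzi hzl))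

/-- Since none of the three is isolated, their velocities agree to leading order. The center
identity multiplies this common value by the unit `g i + g j + g k`, so it is below the order `a⁻¹`
that each velocity has. -/
protected theorem false (t : Triple v z i j k l a m) (h : IsDualPair g c z u)
    (hU : IsUnitData v g c) : False := by
  have h1 := t.not_isolated h hU
  have h2 := t.swap₁.not_isolated h hU
  have h3 := t.swap₂.swap₁.not_isolated h hU
  obtain ⟨hij, hik⟩ : v (u i - u j) < a⁻¹ ∧ v (u i - u k) < a⁻¹ := by
    rw [map_sub_symm v u j i] at h2
    rw [map_sub_symm v u k i, map_sub_symm v u k j] at h3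
    have hA : v (u i - u j) < a⁻¹ → v (u j - u k) < a⁻¹ → v (u i - u k) < a⁻¹ := lt_of_lt_of_lt
    have hB : v (u i - u k) < a⁻¹ → v (u j - u k) < a⁻¹ → v (u i - u j) < a⁻¹ := fun x y =>
      lt_of_lt_of_lt x (by rwa [map_sub_symm])
    tauto
  obtain ⟨f₁, f₂, f₃, hf1, hf2, hf3, hM, -⟩ := t.exists_velocity h hU
  have hf₁₂ : v (f₂ - f₁) < a⁻¹ := by
    have := v.map_sub_lt (v.map_sub_lt hf1 hf2) hij
    rwa [show u i - f₁ - (u j - f₂) - (u i - u j) = f₂ - f₁ by ring] at this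
  have hf₁₃ : v (f₃ - f₁) < a⁻¹ := by
    have := v.map_sub_lt (v.map_sub_lt hf1 hf3) hik
    rwa [show u i - f₁ - (u k - f₃) - (u i - u k) = f₃ - f₁ by ring] at this
  have e : (g i + g j + g k) * f₁ = - (g j * (f₂ - f₁) + g k * (f₃ - f₁)) := by
    linear_combination hM
  have e1 := congrArg v e
  rw [map_mul, hU.triple t.distinct, one_mul, Valuation.map_neg] at e1
  have e2 : v (g j * (f₂ - f₁) + g k * (f₃ - f₁)) < a⁻¹ := by
    refine v.map_add_lt ?_ ?_
    · rwa [map_mul, hU.single, one_mul]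
    · rwa [map_mul, hU.single, one_mul]
  rw [← e1] at e2
  have := v.map_add_lt hf1 e2
  rw [sub_add_cancel, t.map_eq h hU] at this
  exact this.ne rfl

end Triple

/-- By the ultrametric inequality the cluster `i, j, k` is either equilateral, hence a `Triple`, or
has a strictly closest pair. In the latter case `strict_min` makes the other five distances equal,
although `l` is farther away. -/
theorem false_of_far (h : IsDualPair g c z u) (hU : IsUnitData v g c)
    (hd : Distinct i j k l) (hij : v (z i - z j) < v (z i - z l))
    (hik : v (z i - z k) < v (z i - z l)) : False := by
  have hpos := h.left.pos v hd.ij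
  have t1 := map_sub_tri v z i j k
  have t2 := map_sub_tri v z i k j
  have t3 := map_sub_tri v z j i k
  have t4 := map_sub_tri v z j i l
  have t5 := map_sub_tri v z i j l
  have t6 := map_sub_tri v z k i l
  have t7 := map_sub_tri v z i k l
  have s1 := map_sub_symm v z j i
  have s2 := map_sub_symm v z k i
  have s3 := map_sub_symm v z k j
  have hjl : v (z j - z l) = v (z i - z l) := by grind
  have hkl : v (z k - z l) = v (z i - z l) := by grind
  by_cases heq : v (z i - z j) = v (z i - z k) ∧ v (z i - z j) = v (z j - z k)
  · exact (Triple.mk hd hpos hij rfl heq.1.symm heq.2.symm rfl hjl hkl).false h hU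
  by_cases h1 : v (z i - z j) < v (z i - z k)
  · have := h.strict_min hU hd h1 hij (by grind) (by grind) (by grind)
    grind
  by_cases h2 : v (z i - z k) < v (z i - z j)
  · have := h.strict_min hU hd.swap₂ h2 hik (by grind) (by grind) (by grind)
    grind
  · have := h.strict_min hU hd.swap₁.swap₂ (by grind) (by grind) (by grind) (by grind) (by grind)
    grind

/-- At a place where two vortices come together faster than some other pair, they do so faster than
all other pairs, unless the other two vortices form an equally tight pair. -/
theorem strict_min_or_twoPairs (h : IsDualPair g c z u) (hU : IsUnitData v g c)
    (hd : Distinct i j k l) (hlt : ∃ p q, v (z i - z j) < v (z p - z q)) :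
    (v (z i - z j) < v (z i - z k) ∧ v (z i - z j) < v (z i - z l) ∧
      v (z i - z j) < v (z j - z k) ∧ v (z i - z j) < v (z j - z l) ∧
      v (z i - z j) < v (z k - z l)) ∨ ∃ a m, TwoPairs v z i j k l a m := by
  -- If `k` were no farther from `i` than `j` is, then `l` must be far, for otherwise all distances
  -- are at most `v (z i - z j)`; so `i, j, k` would be a cluster with a distant fourth vortex.
  have far : ∀ {i j k l}, Distinct i j k l → (∃ p q, v (z i - z j) < v (z p - z q)) →
      v (z i - z j) < v (z i - z k) := by
    intro i j k l hd hlt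
    by_contra! hik
    have hil : v (z i - z j) < v (z i - z l) := by
      by_contra! hil
      obtain ⟨p, q, hpq⟩ := hlt
      have key : ∀ n, v (z n - z i) ≤ v (z i - z j) := by
        intro n
        have hn : n = i ∨ n = j ∨ n = k ∨ n = l := by
          obtain ⟨h1, h2, h3, h4, h5, h6⟩ := hd
          omega
        rw [map_sub_symm]
        rcases hn with rfl | rfl | rfl | rfl
        · simp
        · exact le_rfl
        · exact hik
        · exact hil
      refine hpq.not_ge ?_
      have := v.map_sub_le (key p) (key q)
      rwa [sub_sub_sub_cancel_right] at this
    exact h.false_of_far hU hd hil (hik.trans_lt hil)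
  have hik := far hd hlt
  have hil := far hd.swap₃ hlt
  have hjk := far hd.swap₁ (by rwa [map_sub_symm])
  have hjl := far hd.swap₁.swap₃ (by rwa [map_sub_symm])
  rw [map_sub_symm v z j i] at hjk hjl
  rcases lt_trichotomy (v (z i - z j)) (v (z k - z l)) with hkl | hkl | hkl
  · exact .inl ⟨hik, hil, hjk, hjl, hkl⟩
  · refine .inr ⟨v (z i - z j), v (z i - z k), hd, h.left.pos v hd.ij, hik, rfl, hkl.symm, rfl,
      ?_, ?_, ?_⟩
    all_goals
      have t1 := map_sub_tri v z i j k
      have t2 := map_sub_tri v z j i k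
      have t3 := map_sub_tri v z i j l
      have t4 := map_sub_tri v z j i l
      have t5 := map_sub_tri v z i k l
      have t6 := map_sub_tri v z i l k
      have s1 := map_sub_symm v z j i
      have s2 := map_sub_symm v z l k
      grind
  -- Here `k, l` is the strictly tightest pair, so `strict_min` equates `v (z i - z j)` with
  -- distances already known to be larger.
  · have s1 := map_sub_symm v z k i
    have s2 := map_sub_symm v z k j
    have s3 := map_sub_symm v z l i
    have s4 := map_sub_symm v z l j
    have := h.strict_min hU hd.swapPairs (by grind) (by grind) (by grind) (by grind) hkl
    grind

end IsDualPair

end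

/-! ### Nonvanishing consequences of `L = 0` -/

section Strengths

variable {Γ : Fin 4 → ℝ} {i j k l : Fin 4}

theorem angularMomentum_eq (Γ : Fin 4 → ℝ) (hd : Distinct i j k l) :
    angularMomentum Γ =
      Γ i * Γ j + Γ i * Γ k + Γ i * Γ l + Γ j * Γ k + Γ j * Γ l + Γ k * Γ l := by
  have h1 : 2 * angularMomentum Γ = (∑ n, Γ n) ^ 2 - ∑ n, Γ n ^ 2 := by
    have h0 : Finset.Ioi (0 : Fin 4) = {1, 2, 3} := by decide
    have h1 : Finset.Ioi (1 : Fin 4) = {2, 3} := by decide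
    have h2 : Finset.Ioi (2 : Fin 4) = {3} := by decide
    have h3 : Finset.Ioi (3 : Fin 4) = ∅ := by decide
    simp [angularMomentum, Fin.sum_univ_four, h0, h1, h2, h3]
    ring
  have h2 : ∀ f : Fin 4 → ℝ, ∑ n, f n = f i + (f j + f k + f l) := fun f => by
    rw [← hd.sum_erase, Finset.add_sum_erase _ _ (Finset.mem_univ i)]
  rw [h2, h2] at h1
  linarith

/-- With a vanishing partial sum, `L = 0` turns into the vanishing of a sum of real squares. The
same device serves for two opposite pairs and for the total vorticity. -/
theorem triple_ne_zero (hΓ : ∀ n, Γ n ≠ 0) (hL : angularMomentum Γ = 0)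
    (hd : Distinct i j k l) : Γ i + Γ j + Γ k ≠ 0 := by
  intro h0
  rw [angularMomentum_eq Γ hd] at hL
  have : Γ i ^ 2 + Γ j ^ 2 + Γ k ^ 2 = 0 := by
    linear_combination (Γ i + Γ j + Γ k + 2 * Γ l) * h0 - 2 * hL
  have h1 := pow_pos (abs_pos.2 (hΓ i)) 2
  rw [sq_abs] at h1
  linarith [sq_nonneg (Γ j), sq_nonneg (Γ k)]

theorem triple_momentum_ne_zero (hΓ : ∀ n, Γ n ≠ 0) (hL : angularMomentum Γ = 0)
    (hd : Distinct i j k l) : Γ i * Γ j + Γ i * Γ k + Γ j * Γ k ≠ 0 := by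
  intro h0
  have h1 := hL
  rw [angularMomentum_eq Γ hd] at h1
  have : Γ l * (Γ i + Γ j + Γ k) = 0 := by linear_combination h1 - h0
  exact (mul_ne_zero (hΓ l) (triple_ne_zero hΓ hL hd)) this

theorem two_pairs_ne_zero (hΓ : ∀ n, Γ n ≠ 0) (hL : angularMomentum Γ = 0)
    (hd : Distinct i j k l) : ¬ (Γ i + Γ j = 0 ∧ Γ k + Γ l = 0) := by
  rintro ⟨h1, h2⟩
  rw [angularMomentum_eq Γ hd] at hL
  have : Γ i ^ 2 + Γ k ^ 2 = 0 := by
    linear_combination (Γ i + Γ k + Γ l) * h1 + (Γ k) * h2 - hL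
  have h3 := pow_pos (abs_pos.2 (hΓ i)) 2
  rw [sq_abs] at h3
  linarith [sq_nonneg (Γ k)]

end Strengths

/-! ### The multiplier forced by a place -/

/-- The strengths of the vortices as elements of a field extension of `ℂ`. -/
def strength (K : Type*) [Field K] [Algebra ℂ K] (Γ : Fin 4 → ℝ) (n : Fin 4) : K :=
  algebraMap ℂ K (Γ n : ℂ)

theorem valuation_const {K : Type*} [Field K] [Algebra ℂ K] {B : ValuationSubring K}
    (hB : ∀ c, algebraMap ℂ K c ∈ B) {c : ℂ} (hc : c ≠ 0) : B.valuation (algebraMap ℂ K c) = 1 := by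
  refine le_antisymm ((B.valuation_le_one_iff _).2 (hB c)) ?_
  have := (B.valuation_le_one_iff _).2 (hB c⁻¹)
  rw [map_inv₀, map_inv₀] at this
  have h0 : 0 < B.valuation (algebraMap ℂ K c) := zero_lt_iff.2 (by simpa using hc)
  exact (inv_le_one₀ h0).1 this

section Place

variable {K : Type*} [Field K] [Algebra ℂ K] {B : ValuationSubring K}

/-- The constants as a subfield of the residue field. -/
def constantHom (hB : ∀ c, algebraMap ℂ K c ∈ B) : ℂ →+* IsLocalRing.ResidueField B :=
  (IsLocalRing.residue B).comp ((algebraMap ℂ K).codRestrict B.toSubring hB)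

variable (hB : ∀ c, algebraMap ℂ K c ∈ B)

theorem hasLimit_const (c : ℂ) : HasLimit B (algebraMap ℂ K c) (constantHom hB c) := ⟨hB c, rfl⟩

end Place

section

variable {K : Type*} [Field K] [Algebra ℂ K] {B : ValuationSubring K} {Γ : Fin 4 → ℝ} {lam : ℂ}
  {z u : Fin 4 → K} {i j k l : Fin 4}

theorem isUnitData (hB : ∀ c, algebraMap ℂ K c ∈ B) (hΓ : ∀ n, Γ n ≠ 0)
    (hL : angularMomentum Γ = 0) (hlam : ‖lam‖ = 1) :
    IsUnitData B.valuation (strength K Γ) (algebraMap ℂ K lam) := by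
  have hv : ∀ r : ℝ, r ≠ 0 → B.valuation (algebraMap ℂ K (r : ℂ)) = 1 := fun r hr =>
    valuation_const hB (Complex.ofReal_ne_zero.2 hr)
  have hpair : ∀ i j, strength K Γ i + strength K Γ j = algebraMap ℂ K ((Γ i + Γ j : ℝ) : ℂ) := by
    intro i j
    simp [strength]
  have hzero : ∀ i j, strength K Γ i + strength K Γ j = 0 ↔ Γ i + Γ j = 0 := by
    intro i j
    rw [hpair, map_eq_zero_iff _ (algebraMap ℂ K).injective, Complex.ofReal_eq_zero]
  refine ⟨valuation_const hB fun h => by simp [h] at hlam, fun n => hv _ (hΓ n), ?_, ?_, ?_, ?_⟩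
  · intro i j
    by_cases h : Γ i + Γ j = 0
    · exact .inl ((hzero i j).2 h)
    · exact .inr (by rw [hpair]; exact hv _ h)
  · intro i j k l hd
    rw [hzero, hzero]
    exact two_pairs_ne_zero hΓ hL hd
  · intro i j k l hd
    rw [← hv _ (triple_ne_zero hΓ hL hd)]
    simp [strength]
  · intro i j k l hd
    rw [← hv _ (triple_momentum_ne_zero hΓ hL hd)]
    simp [strength]

namespace IsDualPair

/-- The limit of a position at a place where the velocity is dominated by one interaction. -/
theorem hasLimit_position {κ : ℂ →+* IsLocalRing.ResidueField B}
    (hκ : ∀ c, HasLimit B (algebraMap ℂ K c) (κ c)) {a y x m : K} {γ : ℂ}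
    {s : IsLocalRing.ResidueField B} (hs : HasLimit B (m * y) s) (hs0 : s ≠ 0)
    (h : B.valuation (a * x - algebraMap ℂ K γ / y) < B.valuation m) :
    HasLimit B (a * (x / m)) (κ γ / s) := by
  have hm : m ≠ 0 := by rintro rfl; simp at h
  have := (hasLimit_div_zero h).add ((hκ γ).div hs hs0)
  rw [zero_add] at this
  convert this using 1
  by_cases hy : y = 0
  · simp [hy, mul_div_assoc]
  · field_simp
    ring

/-- The multiplier determined by a place at which only two vortices come together. -/
theorem mult_eq_of_strict_min (h : IsDualPair (strength K Γ) (algebraMap ℂ K lam) z u)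
    (hB : ∀ c, algebraMap ℂ K c ∈ B) (hΓ : ∀ n, Γ n ≠ 0) (hL : angularMomentum Γ = 0)
    (hlam : ‖lam‖ = 1) (hd : Distinct i j k l)
    (hik : B.valuation (z i - z j) < B.valuation (z i - z k))
    (hil : B.valuation (z i - z j) < B.valuation (z i - z l))
    (hjk : B.valuation (z i - z j) < B.valuation (z j - z k))
    (hjl : B.valuation (z i - z j) < B.valuation (z j - z l))
    (hkl : B.valuation (z i - z j) < B.valuation (z k - z l)) :
    Γ i + Γ j ≠ 0 ∧ lam * (Γ i * Γ j) = - (Γ k * Γ l) := by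
  have hU := isUnitData (lam := lam) hB hΓ hL hlam
  obtain ⟨hij0, hkl0, hzi, hzj, eik, eil, ejk, ejl, eu, ezk, ezl⟩ :=
    h.strict_min hU hd hik hil hjk hjl hkl
  have hadd : ∀ p q, strength K Γ p + strength K Γ q ≠ 0 → Γ p + Γ q ≠ 0 := by
    intro p q hpq h0
    apply hpq
    simp only [strength, ← map_add, ← Complex.ofReal_add, h0, Complex.ofReal_zero, map_zero]
  refine ⟨hadd i j hij0, ?_⟩
  have hκ := hasLimit_const hB
  set κ := constantHom hB
  have hκinj : Function.Injective κ := κ.injective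
  have hm0 := h.left.ne_zero hd.kl
  set m := z k - z l with hm
  have hvm : B.valuation m ≠ 0 := (Valuation.ne_zero_iff _).2 hm0
  obtain ⟨s, hs, hs0⟩ := exists_hasLimit_ne_zero (B := B) (x := m * (u k - u l))
    (by rw [map_mul, eu, mul_inv_cancel₀ hvm])
  have hk := hasLimit_position hκ hs hs0 ezk
  have hl := hasLimit_position (s := -s) hκ
    (by rw [← neg_sub (u k), mul_neg]; exact hs.neg) (neg_ne_zero.2 hs0) ezl
  have hlam0 : lam ≠ 0 := by rintro rfl; simp at hlam
  have hlamK : algebraMap ℂ K lam ≠ 0 := by simpa using hlam0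
  have hκlam : κ lam ≠ 0 := by simpa using hlam0
  have hκΓ : ∀ n, κ (Γ n) ≠ 0 := fun n => by simpa using hΓ n
  have hinv : ∀ {x r}, HasLimit B (algebraMap ℂ K lam * x) r → HasLimit B x (r / κ lam) := by
    intro x r hx
    have := hx.div (hκ lam) hκlam
    rwa [mul_div_cancel_left₀ _ hlamK] at this
  have hk := hinv hk
  have hl := hinv hl
  have hi := hasLimit_div_zero hzi
  have hj := hasLimit_div_zero hzj
  have hrk : κ (Γ l) / s / κ lam ≠ 0 := div_ne_zero (div_ne_zero (hκΓ l) hs0) hκlam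
  have hrl : κ (Γ k) / -s / κ lam ≠ 0 :=
    div_ne_zero (div_ne_zero (hκΓ k) (neg_ne_zero.2 hs0)) hκlam
  have hrkl := hk.sub hl
  rw [← sub_div, ← hm, div_self hm0] at hrkl
  have hrkl := hrkl.unique hasLimit_one
  -- Positions are in units of `m`: vortices `i` and `j` sit at 0, and `k`, `l` are at distance 1,
  -- so their mutual interaction contributes the constants `Γ l` and `-Γ k`.
  have huk := (((hκ (Γ i)).div (hk.sub hi) (by rwa [sub_zero])).add
    ((hκ (Γ j)).div (hk.sub hj) (by rwa [sub_zero]))).add (hκ (Γ l))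
  have hul := (((hκ (Γ i)).div (hl.sub hi) (by rwa [sub_zero])).add
    ((hκ (Γ j)).div (hl.sub hj) (by rwa [sub_zero]))).sub (hκ (Γ k))
  have hukl := huk.sub hul
  have e : m * (u k - u l) = algebraMap ℂ K (Γ i) / (z k / m - z i / m) +
      algebraMap ℂ K (Γ j) / (z k / m - z j / m) + algebraMap ℂ K (Γ l) -
      (algebraMap ℂ K (Γ i) / (z l / m - z i / m) +
      algebraMap ℂ K (Γ j) / (z l / m - z j / m) - algebraMap ℂ K (Γ k)) := by
    have h1 := h.left.ne_zero hd.ik.symm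
    have h2 := h.left.ne_zero hd.jk.symm
    have h3 := h.left.ne_zero hd.il.symm
    have h4 := h.left.ne_zero hd.jl.symm
    rw [h.left.eq_add hd.swapPairs.swap₂.swap₃, h.left.eq_add hd.swapPairs.swap₁.swap₂.swap₃,
      ← hm, ← neg_sub (z k), ← hm]
    simp only [← sub_div, strength]
    field_simp
    ring
  rw [← e] at hukl
  have hfin := hs.unique hukl
  have hκeq : κ (lam * (Γ i * Γ j)) = κ (- (Γ k * Γ l)) := by
    have hLk : κ (Γ i) * κ (Γ j) + κ (Γ i) * κ (Γ k) + κ (Γ i) * κ (Γ l) + κ (Γ j) * κ (Γ k) +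
        κ (Γ j) * κ (Γ l) + κ (Γ k) * κ (Γ l) = 0 := by
      rw [angularMomentum_eq Γ hd] at hL
      simp only [← map_mul, ← map_add, ← Complex.ofReal_mul, ← Complex.ofReal_add, hL,
        Complex.ofReal_zero, map_zero]
    simp only [map_mul, map_neg]
    generalize κ (Γ i) = a at *
    generalize κ (Γ j) = b at *
    have hc := hκΓ k
    have hd' := hκΓ l
    generalize κ (Γ k) = c at *
    generalize κ (Γ l) = d at *
    generalize κ lam = q at *
    have hs1 : c + d = q * s := by
      field_simp at hrkl
      linear_combination hrkl
    simp only [sub_zero, div_div_eq_mul_div, div_neg, neg_div] at hfin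
    field_simp at hfin
    refine mul_left_cancel₀ hs0 ?_
    linear_combination hfin + s * q * hLk + c * d * hs1
  exact_mod_cast hκinj hκeq

/-- The multiplier at a place with two equally tight pairs cannot have modulus one. -/
theorem false_of_crossed {a m : B.ValueGroup}
    (h : IsDualPair (strength K Γ) (algebraMap ℂ K lam) z u)
    (hB : ∀ c, algebraMap ℂ K c ∈ B) (hΓ : ∀ n, Γ n ≠ 0) (hL : angularMomentum Γ = 0)
    (hlam : ‖lam‖ = 1) (t : TwoPairs B.valuation z i j k l a m)
    (hik : B.valuation (u i - u k) < a⁻¹) : False := by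
  have hd := t.distinct
  have hU := isUnitData (lam := lam) hB hΓ hL hlam
  obtain ⟨eik, ei, ek, hjl⟩ := t.crossed h hU hik
  obtain ⟨ejl, ej, el, -⟩ := t.swap₁.swap₃.crossed h hU hjl
  have hκ := hasLimit_const hB
  set κ := constantHom hB
  have hκinj : Function.Injective κ := κ.injective
  have hm0 : z i - z k ≠ 0 := h.left.ne_zero hd.ik
  obtain ⟨r, hr⟩ : ∃ r, r = z i - z k := ⟨_, rfl⟩
  have hr0 : r ≠ 0 := hr ▸ hm0
  have hvr : B.valuation r = m := hr ▸ t.ik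
  have hmpos : m ≠ 0 := (t.pos.trans t.lt).ne'
  have ham : a < B.valuation r := hvr ▸ t.lt
  obtain ⟨s, hs, hs0⟩ := exists_hasLimit_ne_zero (B := B) (x := r * (u i - u k))
    (by rw [map_mul, eik, hvr, mul_inv_cancel₀ hmpos])
  obtain ⟨s', hs', hs0'⟩ := exists_hasLimit_ne_zero (B := B) (x := r * (u j - u l))
    (by rw [map_mul, ejl, hvr, mul_inv_cancel₀ hmpos])
  have hi := hasLimit_position hκ hs hs0 (ei.trans_lt ham)
  have hj := hasLimit_position hκ hs' hs0' (ej.trans_lt ham)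
  have hk := hasLimit_position (s := -s) hκ
    (by rw [← neg_sub (u i), mul_neg]; exact hs.neg) (neg_ne_zero.2 hs0) (ek.trans_lt ham)
  have hl := hasLimit_position (s := -s') hκ
    (by rw [← neg_sub (u j), mul_neg]; exact hs'.neg) (neg_ne_zero.2 hs0') (el.trans_lt ham)
  have hij := hasLimit_div_zero (t.ij.trans_lt ham)
  have hkl := hasLimit_div_zero (t.kl.trans_lt ham)
  have hik1 : HasLimit B ((z i - z k) / r) 1 := by
    rw [← hr, div_self hr0]; exact hasLimit_one
  have hil1 : HasLimit B ((z i - z l) / r) 1 := by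
    have := hik1.add hkl
    rwa [← add_div, sub_add_sub_cancel, add_zero] at this
  have hjk1 : HasLimit B ((z j - z k) / r) 1 := by
    have := hik1.sub hij
    rwa [← sub_div, sub_sub_sub_cancel_left, sub_zero] at this
  have hjl1 : HasLimit B ((z j - z l) / r) 1 := by
    have := hil1.sub hij
    rwa [← sub_div, sub_sub_sub_cancel_left, sub_zero] at this
  have hdiff : ∀ {p q : Fin 4} {x y w : IsLocalRing.ResidueField B},
      HasLimit B (algebraMap ℂ K lam * (z p / r)) x →
      HasLimit B (algebraMap ℂ K lam * (z q / r)) y → HasLimit B ((z p - z q) / r) w →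
      x - y = κ lam * w := by
    intro p q x y w hx hy hw
    have h1 := hx.sub hy
    rw [← mul_sub, ← sub_div] at h1
    exact h1.unique ((hκ lam).mul hw)
  have e1 := hdiff hi hj hij
  have e2 := hdiff hk hl hkl
  have e3 := hdiff hi hk hik1
  rw [mul_zero] at e1 e2
  rw [mul_one] at e3
  have hκΓ : ∀ n, κ (Γ n) ≠ 0 := fun n => by simpa using hΓ n
  -- In the limit `i` meets `j` and `k` meets `l`, so `Γ k / s = Γ l / s'` and `Γ i / s = Γ j / s'`.
  have hprod : Γ i * Γ l = Γ j * Γ k := by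
    have : κ (Γ i * Γ l : ℂ) = κ (Γ j * Γ k : ℂ) := by
      simp only [map_mul]
      have hj := hκΓ j
      field_simp at e1 e2
      refine mul_left_cancel₀ hs0 ?_
      linear_combination (-κ (Γ i)) * e1 - κ (Γ k) * e2
    exact_mod_cast hκinj this
  have hprodK : algebraMap ℂ K (Γ i) * algebraMap ℂ K (Γ l) =
      algebraMap ℂ K (Γ j) * algebraMap ℂ K (Γ k) := by
    simp only [← map_mul, ← Complex.ofReal_mul, hprod]
  -- These weights cancel both singular interactions: `i` with `j` by antisymmetry, `k` with `l` by
  -- `hprod`. What remains has a finite limit.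
  have e : algebraMap ℂ K (Γ i) * (r * (u i - u k)) + algebraMap ℂ K (Γ j) * (r * (u j - u l)) =
      algebraMap ℂ K (Γ i * (Γ i + Γ k) : ℂ) / ((z i - z k) / r) +
      algebraMap ℂ K (Γ i * (Γ j + Γ l) : ℂ) / ((z i - z l) / r) +
      algebraMap ℂ K (Γ j * (Γ i + Γ k) : ℂ) / ((z j - z k) / r) +
      algebraMap ℂ K (Γ j * (Γ j + Γ l) : ℂ) / ((z j - z l) / r) := by
    rw [h.left.eq_add hd, h.left.eq_add hd.swap₁, h.left.eq_add hd.swapPairs,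
      h.left.eq_add hd.swapPairs.swap₁, ← neg_sub (z i) (z j), ← neg_sub (z i) (z k),
      ← neg_sub (z i) (z l), ← neg_sub (z j) (z k), ← neg_sub (z j) (z l), ← neg_sub (z k) (z l)]
    simp only [strength, div_eq_mul_inv, mul_inv, inv_inv, inv_neg, map_mul, map_add]
    linear_combination (- r * (z k - z l)⁻¹) * hprodK
  have hlim := ((((hκ (Γ i * (Γ i + Γ k))).div hik1 one_ne_zero).add
    ((hκ (Γ i * (Γ j + Γ l))).div hil1 one_ne_zero)).add
    ((hκ (Γ j * (Γ i + Γ k))).div hjk1 one_ne_zero)).add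
    ((hκ (Γ j * (Γ j + Γ l))).div hjl1 one_ne_zero)
  rw [← e] at hlim
  have hfin := hlim.unique (((hκ (Γ i)).mul hs).add ((hκ (Γ j)).mul hs'))
  have hne : (Γ i + Γ k : ℂ) ≠ 0 := by
    intro h0
    have : κ (Γ k) + κ (Γ i) = κ lam * s := by
      field_simp at e3
      linear_combination e3
    rw [← map_add, add_comm, h0, map_zero, zero_eq_mul] at this
    have hlam0 : lam ≠ 0 := by rintro rfl; simp at hlam
    exact this.elim (by simpa using hlam0) hs0
  have hκeq : κ ((Γ i + Γ k) * (Γ i ^ 2 + Γ j ^ 2) : ℂ) =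
      κ ((Γ i + Γ k) * (lam * (Γ i + Γ j) ^ 2) : ℂ) := by
    have hprodκ : κ (Γ i) * κ (Γ l) = κ (Γ j) * κ (Γ k) := by
      simp only [← map_mul, ← Complex.ofReal_mul, hprod]
    have hc := hκΓ i
    simp only [map_mul, map_add, map_pow, div_one] at hfin ⊢
    generalize κ (Γ i) = a at *
    generalize κ (Γ j) = b at *
    generalize κ (Γ k) = c at *
    generalize κ (Γ l) = d at *
    generalize κ lam = q at *
    have hs1 : a + c = q * s := by
      field_simp at e3
      linear_combination e3
    have hs2 : s * b = s' * a := by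
      field_simp at e2
      linear_combination e2
    linear_combination (a ^ 2 + b ^ 2) * hs1 - q * a * hfin + q * b * hs2 +
      q * (a + b) * hprodκ
  have hC := mul_left_cancel₀ hne (hκinj hκeq)
  have hnorm := congrArg norm hC
  rw [norm_mul, hlam, one_mul] at hnorm
  -- Both sides are nonnegative reals, so a multiplier of modulus one disappears on taking norms.
  have hreal : Γ i ^ 2 + Γ j ^ 2 = (Γ i + Γ j) ^ 2 := by
    have h1 : ‖((Γ i ^ 2 + Γ j ^ 2 : ℝ) : ℂ)‖ = ‖(((Γ i + Γ j) ^ 2 : ℝ) : ℂ)‖ := by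
      push_cast; exact hnorm
    rwa [Complex.norm_real, Complex.norm_real, Real.norm_of_nonneg (by positivity),
      Real.norm_of_nonneg (by positivity)] at h1
  have : Γ i * Γ j = 0 := by linarith
  exact mul_ne_zero (hΓ i) (hΓ j) this

/-- The conditions on the strengths imposed by a place where two given vortices come together. -/
theorem mult_eq_of_lt (h : IsDualPair (strength K Γ) (algebraMap ℂ K lam) z u)
    (hB : ∀ c, algebraMap ℂ K c ∈ B) (hΓ : ∀ n, Γ n ≠ 0) (hL : angularMomentum Γ = 0)
    (hlam : ‖lam‖ = 1) (hd : Distinct i j k l)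
    (hlt : ∃ p q, B.valuation (z i - z j) < B.valuation (z p - z q)) :
    Γ i + Γ j ≠ 0 ∧ lam * (Γ i * Γ j) = - (Γ k * Γ l) := by
  have hU := isUnitData (lam := lam) hB hΓ hL hlam
  rcases h.strict_min_or_twoPairs hU hd hlt with ⟨h1, h2, h3, h4, h5⟩ | ⟨a, m, t⟩
  · exact h.mult_eq_of_strict_min hB hΓ hL hlam hd h1 h2 h3 h4 h5
  · rcases t.not_isolated h hU with hik | hil
    · exact (h.false_of_crossed hB hΓ hL hlam t hik).elim
    · exact (h.false_of_crossed hB hΓ hL hlam t.swap₃ hil).elim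

end IsDualPair

end

/-! ### From places to finiteness -/

theorem center_eq {K : Type*} [Field K] {g z w : Fin 4 → K} (h : IsField g z w) :
    g 0 * w 0 + g 1 * w 1 + g 2 * w 2 + g 3 * w 3 = 0 := by
  rw [h.eq_add (i := 0) (j := 1) (k := 2) (l := 3) (by constructor <;> decide),
    h.eq_add (i := 1) (j := 0) (k := 2) (l := 3) (by constructor <;> decide),
    h.eq_add (i := 2) (j := 0) (k := 1) (l := 3) (by constructor <;> decide),
    h.eq_add (i := 3) (j := 0) (k := 1) (l := 2) (by constructor <;> decide),
    ← neg_sub (z 0) (z 1), ← neg_sub (z 0) (z 2), ← neg_sub (z 0) (z 3), ← neg_sub (z 1) (z 2),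
    ← neg_sub (z 1) (z 3), ← neg_sub (z 2) (z 3)]
  simp only [div_neg]
  ring

theorem total_ne_zero {Γ : Fin 4 → ℝ} (hΓ : ∀ n, Γ n ≠ 0) (hL : angularMomentum Γ = 0) :
    Γ 0 + Γ 1 + Γ 2 + Γ 3 ≠ 0 := by
  intro h0
  rw [angularMomentum_eq Γ (i := 0) (j := 1) (k := 2) (l := 3) (by constructor <;> decide)] at hL
  have h1 := pow_pos (abs_pos.2 (hΓ 0)) 2
  rw [sq_abs] at h1
  have : Γ 0 ^ 2 + Γ 1 ^ 2 + Γ 2 ^ 2 + Γ 3 ^ 2 = 0 := by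
    linear_combination (Γ 0 + Γ 1 + Γ 2 + Γ 3) * h0 - 2 * hL
  linarith [sq_nonneg (Γ 1), sq_nonneg (Γ 2), sq_nonneg (Γ 3)]

section Strengths

variable {Γ : Fin 4 → ℝ} {lam : ℂ}

/-- The necessary conditions for collisions of all pairs are incompatible. -/
theorem false_of_forall_pairs (hΓ : ∀ n, Γ n ≠ 0) (hL : angularMomentum Γ = 0) (hlam : ‖lam‖ = 1)
    (h : ∀ {i j k l}, Distinct i j k l →
      Γ i + Γ j ≠ 0 ∧ lam * (Γ i * Γ j) = - (Γ k * Γ l)) : False := by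
  have hsq : ∀ {i j k l}, Distinct i j k l → (Γ i * Γ j) ^ 2 = (Γ k * Γ l) ^ 2 := by
    intro i j k l hd
    have := congrArg norm (h hd).2
    rw [norm_mul, hlam, one_mul, norm_neg, ← Complex.ofReal_mul, ← Complex.ofReal_mul,
      Complex.norm_real, Complex.norm_real, Real.norm_eq_abs, Real.norm_eq_abs] at this
    exact (sq_eq_sq_iff_abs_eq_abs _ _).2 this
  have heq : ∀ {i j k l}, Distinct i j k l → Γ i = Γ l := by
    intro i j k l hd
    have h1 := hsq hd
    have h2 := hsq hd.swap₂
    -- Multiply `Γ_i² Γ_j² = Γ_k² Γ_l²` by `Γ_i² Γ_k² = Γ_j² Γ_l²`; below, `Γ_i + Γ_l ≠ 0` excludes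
    -- the opposite sign.
    have h3 : (Γ i ^ 2) ^ 2 = (Γ l ^ 2) ^ 2 := by
      refine mul_left_cancel₀ (pow_ne_zero 2 (mul_ne_zero (hΓ j) (hΓ k))) ?_
      linear_combination (Γ i * Γ k) ^ 2 * h1 + (Γ k * Γ l) ^ 2 * h2
    have h4 : Γ i ^ 2 = Γ l ^ 2 := (sq_eq_sq₀ (sq_nonneg _) (sq_nonneg _)).1 h3
    refine (sq_eq_sq_iff_eq_or_eq_neg.1 h4).resolve_right fun h5 => ?_
    exact (h hd.swap₃.swap₂).1 (by rw [h5, neg_add_cancel])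
  have hd : Distinct 0 1 2 3 := by constructor <;> decide
  rw [angularMomentum_eq Γ hd, ← heq hd, ← heq hd.swap₃, ← heq hd.swap₂.swap₃] at hL
  have h1 := pow_pos (abs_pos.2 (hΓ 0)) 2
  rw [sq_abs] at h1
  linarith

/-- A nonconstant ratio vanishes at some place, so otherwise every `(z i - z j) / (z p - z q)` is
constant. Taking `z p - z q = z 1 - z 0 = 1` makes all differences constant, and `∑ Γ_n z_n = 0`
with nonzero total vorticity then recovers the positions. -/
theorem exists_valuation_lt {K : Type*} [Field K] [Algebra ℂ K] {z u : Fin 4 → K}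
    (h : IsDualPair (strength K Γ) (algebraMap ℂ K lam) z u)
    (hΓ : ∀ n, Γ n ≠ 0) (hL : angularMomentum Γ = 0) (hlam : ‖lam‖ = 1)
    (h1 : z 1 - z 0 = 1) (hz : ∃ n, z n ∉ Set.range (algebraMap ℂ K)) {i j : Fin 4}
    (hij : i ≠ j) :
    ∃ B : ValuationSubring K, (∀ c, algebraMap ℂ K c ∈ B) ∧
      ∃ p q, B.valuation (z i - z j) < B.valuation (z p - z q) := by
  by_contra! hcon
  let F : Subfield K := (algebraMap ℂ K).fieldRange
  have hF : ∀ x, x ∈ F ↔ x ∈ Set.range (algebraMap ℂ K) := fun x => Iff.rfl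
  have hratio : ∀ p q, p ≠ q → (z i - z j) / (z p - z q) ∈ F := by
    intro p q hpq
    by_contra hnot
    obtain ⟨B, hB, hlt⟩ := exists_valuationSubring_lt_one hnot
    rw [map_div₀, div_lt_one₀ (h.left.pos B.valuation hpq)] at hlt
    exact (hcon B hB p q).not_gt hlt
  have hbase : z i - z j ∈ F := by
    have := hratio 1 0 (by decide)
    rwa [h1, div_one] at this
  have hdiff : ∀ p q, z p - z q ∈ F := by
    intro p q
    by_cases hpq : p = q
    · simp [hpq, F.zero_mem]
    · have := F.div_mem hbase (hratio p q hpq)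
      rwa [div_div_cancel₀ (h.left.ne_zero hij)] at this
  have hg : ∀ n, strength K Γ n ∈ F := fun n => ⟨_, rfl⟩
  have hlam0 : algebraMap ℂ K lam ≠ 0 := by
    rw [map_ne_zero]; rintro rfl; simp at hlam
  have hcenter := center_eq h.right
  have htot : strength K Γ 0 + strength K Γ 1 + strength K Γ 2 + strength K Γ 3 ≠ 0 := by
    simp only [strength, ← map_add, ← Complex.ofReal_add]
    rw [map_ne_zero]
    exact Complex.ofReal_ne_zero.2 (total_ne_zero hΓ hL)
  obtain ⟨n, hn⟩ := hz
  refine hn ((hF _).1 ?_)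
  have e : z n = (strength K Γ 0 * (z n - z 0) + strength K Γ 1 * (z n - z 1) +
      strength K Γ 2 * (z n - z 2) + strength K Γ 3 * (z n - z 3)) /
      (strength K Γ 0 + strength K Γ 1 + strength K Γ 2 + strength K Γ 3) := by
    rw [eq_div_iff htot]
    refine mul_left_cancel₀ hlam0 ?_
    linear_combination hcenter
  rw [e]
  have hterm : ∀ p, strength K Γ p * (z n - z p) ∈ F := fun p => F.mul_mem (hg p) (hdiff n p)
  exact F.div_mem (F.add_mem (F.add_mem (F.add_mem (hterm 0) (hterm 1)) (hterm 2)) (hterm 3))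
    (F.add_mem (F.add_mem (F.add_mem (hg 0) (hg 1)) (hg 2)) (hg 3))

/-- The coordinates of the variety of dual pairs: positions, velocities, and the inverses of their
differences. -/
abbrev Coordinate : Type := (Fin 4 ⊕ Fin 4) ⊕ (Fin 4 × Fin 4) ⊕ (Fin 4 × Fin 4)

/-- The point with coordinates `z`, `u`, `1 / (z_j - z_k)`, `1 / (u_j - u_k)`. -/
def coordinates (z u : Fin 4 → ℂ) : Coordinate → ℂ :=
  Sum.elim (Sum.elim z u)
    (Sum.elim (fun p => (z p.1 - z p.2)⁻¹) fun p => (u p.1 - u p.2)⁻¹)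

-- Including the inverse differences as coordinates makes the system polynomial and encodes the
-- absence of collisions, so the generic point is again a collision-free dual pair, over `K`.
open MvPolynomial in
theorem finite_dualPairs (hΓ : ∀ n, Γ n ≠ 0) (hL : angularMomentum Γ = 0) (hlam : ‖lam‖ = 1) :
    {z : Fin 4 → ℂ | z 1 - z 0 = 1 ∧ ∃ u, IsDualPair (strength ℂ Γ) lam z u}.Finite := by
  by_contra hinf
  let S : Set (Coordinate → ℂ) := {s | ∃ z u, z 1 - z 0 = 1 ∧
    IsDualPair (strength ℂ Γ) lam z u ∧ coordinates z u = s}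
  have hS : S.Infinite := by
    intro hfin
    refine hinf ((hfin.image fun s n => s (.inl (.inl n))).subset ?_)
    rintro z ⟨h1, u, h⟩
    exact ⟨coordinates z u, ⟨z, u, h1, h, rfl⟩, rfl⟩
  obtain ⟨K, _, _, x, hx, hgen⟩ := exists_generic_point hS
  set z : Fin 4 → K := fun n => x (.inl (.inl n)) with hz
  set u : Fin 4 → K := fun n => x (.inl (.inr n)) with hu
  let W : Fin 4 → Fin 4 → K := fun j k => x (.inr (.inl (j, k)))
  let Z : Fin 4 → Fin 4 → K := fun j k => x (.inr (.inr (j, k)))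
  have hW : ∀ j k, j ≠ k → W j k * (z j - z k) = 1 := by
    intro j k hjk
    have := hx (X (.inr (.inl (j, k))) * (X (.inl (.inl j)) - X (.inl (.inl k))) - 1) ?_
    · simpa [sub_eq_zero] using this
    · rintro s ⟨z, u, -, h, rfl⟩
      simp [coordinates, h.left.ne_zero hjk]
  have hZ : ∀ j k, j ≠ k → Z j k * (u j - u k) = 1 := by
    intro j k hjk
    have := hx (X (.inr (.inr (j, k))) * (X (.inl (.inr j)) - X (.inl (.inr k))) - 1) ?_
    · simpa [sub_eq_zero] using this
    · rintro s ⟨z, u, -, h, rfl⟩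
      simp [coordinates, h.right.ne_zero hjk]
  -- On the diagonal the coordinate is `0⁻¹ = 0`.
  have hW0 : ∀ j, W j j = 0 := by
    intro j
    have := hx (X (.inr (.inl (j, j)))) ?_
    · simpa using this
    · rintro s ⟨z, u, -, h, rfl⟩
      simp [coordinates]
  have hZ0 : ∀ j, Z j j = 0 := by
    intro j
    have := hx (X (.inr (.inr (j, j)))) ?_
    · simpa using this
    · rintro s ⟨z, u, -, h, rfl⟩
      simp [coordinates]
  have hWinv : ∀ j k, W j k = (z j - z k)⁻¹ := by
    intro j k
    by_cases hjk : j = k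
    · simp [hjk, hW0]
    · exact eq_inv_of_mul_eq_one_left (hW j k hjk)
  have hZinv : ∀ j k, Z j k = (u j - u k)⁻¹ := by
    intro j k
    by_cases hjk : j = k
    · simp [hjk, hZ0]
    · exact eq_inv_of_mul_eq_one_left (hZ j k hjk)
  have huz : ∀ n, u n = ∑ j ∈ Finset.univ.erase n, strength K Γ j / (z n - z j) := by
    intro n
    have := hx (X (.inl (.inr n)) - ∑ j ∈ Finset.univ.erase n,
      C (Γ j : ℂ) * X (.inr (.inl (n, j)))) ?_
    · simp only [map_sub, map_sum, map_mul, aeval_X, sub_eq_zero, algHom_C] at this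
      refine this.trans (Finset.sum_congr rfl fun j _ => ?_)
      rw [div_eq_mul_inv, ← hWinv]; rfl
    · rintro s ⟨z, u, -, h, rfl⟩
      simp only [map_sub, map_sum, map_mul, eval_X, eval_C, sub_eq_zero]
      exact (h.left.eq n).trans (Finset.sum_congr rfl fun j _ => div_eq_mul_inv _ _)
  have hzu : ∀ n, algebraMap ℂ K lam * z n =
      ∑ j ∈ Finset.univ.erase n, strength K Γ j / (u n - u j) := by
    intro n
    have := hx (C lam * X (.inl (.inl n)) - ∑ j ∈ Finset.univ.erase n,
      C (Γ j : ℂ) * X (.inr (.inr (n, j)))) ?_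
    · simp only [map_sub, map_sum, map_mul, aeval_X, sub_eq_zero, algHom_C] at this
      refine this.trans (Finset.sum_congr rfl fun j _ => ?_)
      rw [div_eq_mul_inv, ← hZinv]; rfl
    · rintro s ⟨z, u, -, h, rfl⟩
      simp only [map_sub, map_sum, map_mul, eval_X, eval_C, sub_eq_zero]
      exact (h.right.eq n).trans (Finset.sum_congr rfl fun j _ => div_eq_mul_inv _ _)
  have h1 : z 1 - z 0 = 1 := by
    have := hx (X (.inl (.inl 1)) - X (.inl (.inl 0)) - 1) ?_
    · simpa [sub_eq_zero] using this
    · rintro s ⟨z, u, h1, h, rfl⟩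
      simp [coordinates, h1]
  have hinjz : Function.Injective z := fun j k hjk => by
    by_contra hne
    simpa [hjk] using hW j k hne
  have hinju : Function.Injective u := fun j k hjk => by
    by_contra hne
    simpa [hjk] using hZ j k hne
  have hpair : IsDualPair (strength K Γ) (algebraMap ℂ K lam) z u :=
    ⟨⟨hinjz, huz⟩, ⟨hinju, hzu⟩⟩
  -- The transcendental coordinate may be any of the four kinds, but all are rational functions of
  -- `z` over `ℂ`.
  have hnc : ∃ n, z n ∉ Set.range (algebraMap ℂ K) := by
    by_contra! hall
    let F : Subfield K := (algebraMap ℂ K).fieldRange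
    have hzF : ∀ n, z n ∈ F := hall
    have hg : ∀ n, strength K Γ n ∈ F := fun n => ⟨_, rfl⟩
    have huF : ∀ n, u n ∈ F := fun n => by
      rw [huz]
      exact F.sum_mem fun j _ => F.div_mem (hg j) (F.sub_mem (hzF n) (hzF j))
    obtain ⟨c, hc⟩ := hgen
    refine hc ?_
    change x c ∈ F
    rcases c with (n | n) | ⟨j, k⟩ | ⟨j, k⟩
    · exact hzF n
    · exact huF n
    · change W j k ∈ F
      rw [hWinv]
      exact F.inv_mem (F.sub_mem (hzF j) (hzF k))
    · change Z j k ∈ F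
      rw [hZinv]
      exact F.inv_mem (F.sub_mem (huF j) (huF k))
  refine false_of_forall_pairs hΓ hL hlam fun {i j k l} hd => ?_
  obtain ⟨B, hB, hlt⟩ := exists_valuation_lt hpair hΓ hL hlam h1 hnc hd.ij
  exact hpair.mult_eq_of_lt hB hΓ hL hlam hd hlt

/-- A configuration with velocities `Λ (z_n - z₀)`, rescaled, belongs to a dual pair. -/
theorem finiteUpToSimilarity_of_velocity (hΓ : ∀ n, Γ n ≠ 0) (hL : angularMomentum Γ = 0)
    (hlam : ‖lam‖ = 1) {S : Set (Fin 4 → ℂ)}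
    (hS : ∀ z ∈ S, Function.Injective z ∧ ∃ Λ z₀ : ℂ, Λ ≠ 0 ∧ Λ / (starRingEnd ℂ) Λ = lam ∧
      ∀ n, velocity Γ z n = Λ * (z n - z₀)) : FiniteUpToSimilarity S := by
  refine ((finite_dualPairs hΓ hL hlam).image (Quotient.mk similarity)).subset ?_
  rintro _ ⟨z, hz, rfl⟩
  obtain ⟨hinj, Λ, z₀, hΛ, hlam', hv⟩ := hS z hz
  have hΛ' : (starRingEnd ℂ) Λ ≠ 0 := by simpa using hΛ
  have h10 : z 1 - z 0 ≠ 0 := sub_ne_zero.2 fun h => absurd (hinj h) (by decide)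
  obtain ⟨b, hb⟩ : ∃ b, b = (z 1 - z 0)⁻¹ := ⟨_, rfl⟩
  have hb0 : b ≠ 0 := hb ▸ inv_ne_zero h10
  -- Conjugating the equation gives `F(z) = conj Λ * conj (z - z₀)`; since `F` has degree `-1`,
  -- scaling `z` by `b` scales this by `b⁻¹`.
  refine ⟨fun n => b * (z n + -z₀), ⟨?_, fun n => b⁻¹ * ((starRingEnd ℂ) Λ *
    (starRingEnd ℂ) (z n - z₀)), ⟨?_, fun n => ?_⟩, ?_, fun n => ?_⟩, ?_⟩
  · rw [hb]; field_simp; ring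
  · intro j k hjk
    exact hinj (add_right_cancel (mul_left_cancel₀ hb0 hjk))
  · rw [← map_mul, ← hv, velocity, map_sum, Finset.mul_sum]
    refine Finset.sum_congr rfl fun j _ => ?_
    simp only [map_div₀, Complex.conj_ofReal, Complex.conj_conj, strength,
      Algebra.algebraMap_self, RingHom.id_apply]
    rw [← mul_sub, add_sub_add_right_eq_sub, div_eq_mul_inv, div_eq_mul_inv, mul_inv]
    ring
  · intro j k hjk
    have := mul_left_cancel₀ hΛ' (mul_left_cancel₀ (inv_ne_zero hb0) hjk)
    exact hinj (sub_left_injective ((starRingEnd ℂ).injective this))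
  · have e : lam * (b * (z n + -z₀)) = b * ((starRingEnd ℂ) Λ)⁻¹ * (Λ * (z n - z₀)) := by
      rw [← hlam']; field_simp; ring
    rw [e, ← hv, velocity, Finset.mul_sum]
    refine Finset.sum_congr rfl fun j _ => ?_
    simp only [strength, Algebra.algebraMap_self, RingHom.id_apply, ← mul_sub, ← map_sub,
      sub_sub_sub_cancel_right, div_eq_mul_inv, mul_inv, inv_inv]
    ring
  · exact Quotient.sound (similarity.symm ⟨-z₀, b, hb0, fun n => rfl⟩)

end Strengths

/-! ### Normalized central configurations -/

variable {Γ : Fin 4 → ℝ} {Λ : ℂ}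

/-- The only central configuration with given positions. -/
def configOfPositions (Γ : Fin 4 → ℝ) (Λ : ℂ) (z : Fin 4 → ℂ) : ComplexConfig :=
  let w : Fin 4 → ℂ := fun n => Λ * ∑ j ∈ Finset.univ.erase n, (Γ j : ℂ) / (z n - z j)
  (z, fun j k => (w k - w j)⁻¹, w, fun j k => (z k - z j)⁻¹)

theorem eq_inv_of_antisymm {x : Fin 4 → ℂ} {Y : Fin 4 → Fin 4 → ℂ}
    (h : ∀ j k, j < k → Y j k * (x k - x j) = 1) (ha : ∀ j k, Y j k = -Y k j) (j k : Fin 4) :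
    Y j k = (x k - x j)⁻¹ := by
  rcases lt_trichotomy j k with hjk | rfl | hjk
  · exact eq_inv_of_mul_eq_one_left (h j k hjk)
  · rw [sub_self, inv_zero]
    exact self_eq_neg.1 (ha j j)
  · rw [ha, eq_inv_of_mul_eq_one_left (h k j hjk), ← inv_neg, neg_sub]

theorem injective_of_forall_lt {x : Fin 4 → ℂ} {Y : Fin 4 → Fin 4 → ℂ}
    (h : ∀ j k, j < k → Y j k * (x k - x j) = 1) : Function.Injective x := by
  intro j k hjk
  by_contra hne
  rcases lt_or_gt_of_ne hne with hlt | hlt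
  · simpa [hjk] using h _ _ hlt
  · simpa [hjk] using h _ _ hlt

theorem finite_sq_eq (d : ℂ) : {c : ℂ | c ^ 2 = d}.Finite := by
  obtain ⟨s, rfl⟩ := IsAlgClosed.exists_pow_nat_eq d (n := 2) (by norm_num)
  refine (Set.toFinite {s, -s}).subset fun c hc => ?_
  exact sq_eq_sq_iff_eq_or_eq_neg.1 hc

/-- With `c = z 1 - z 0`, the vectors `c⁻¹ z` and `c Λ⁻¹ w` form a dual pair of multiplier `Λ ^ 2`.
The normalization `z 1 - z 0 = w 1 - w 0` determines `c ^ 2` from that pair, so at most two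
configurations lie over each `c⁻¹ z`. -/
theorem finite_normalizedCentral (hΓ : ∀ n, Γ n ≠ 0) (hL : angularMomentum Γ = 0)
    (hΛ : ‖Λ‖ = 1) : {Q | IsNormalizedCentral Γ Λ Q}.Finite := by
  have hΛ0 : Λ ≠ 0 := by rintro rfl; simp at hΛ
  have hfin := finite_dualPairs (lam := Λ ^ 2) hΓ hL (by rw [norm_pow, hΛ, one_pow])
  let F : (Fin 4 → ℂ) → Fin 4 → ℂ := fun z n =>
    ∑ j ∈ Finset.univ.erase n, (Γ j : ℂ) / (z n - z j)
  refine ((hfin.biUnion fun z _ => (finite_sq_eq (Λ * (F z 1 - F z 0))).image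
    fun c => configOfPositions Γ Λ fun n => c * z n)).subset ?_
  rintro ⟨z, Z, w, W⟩ ⟨hz, hw, hZ, hW, hZa, hWa, h10⟩
  have hzinj := injective_of_forall_lt hW
  have hwinj := injective_of_forall_lt hZ
  have hZinv := eq_inv_of_antisymm hZ hZa
  have hWinv := eq_inv_of_antisymm hW hWa
  have hw' : ∀ n, w n = Λ * ∑ j ∈ Finset.univ.erase n, (Γ j : ℂ) / (z n - z j) := by
    intro n
    rw [← inv_mul_eq_iff_eq_mul₀ hΛ0, hw]
    exact Finset.sum_congr rfl fun j _ => by rw [hWinv, div_eq_mul_inv]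
  have hz' : ∀ n, Λ * z n = ∑ j ∈ Finset.univ.erase n, (Γ j : ℂ) / (w n - w j) := by
    intro n
    rw [hz]
    exact Finset.sum_congr rfl fun j _ => by rw [hZinv, div_eq_mul_inv]
  obtain ⟨c, hc⟩ : ∃ c, c = z 1 - z 0 := ⟨_, rfl⟩
  have hc0 : c ≠ 0 := hc ▸ sub_ne_zero.2 fun h => absurd (hzinj h) (by decide)
  have hF : ∀ n, F (fun n => c⁻¹ * z n) n = c * Λ⁻¹ * w n := by
    intro n
    rw [hw', mul_assoc, inv_mul_cancel_left₀ hΛ0, Finset.mul_sum]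
    refine Finset.sum_congr rfl fun j _ => ?_
    rw [← mul_sub, div_eq_mul_inv, div_eq_mul_inv, mul_inv, inv_inv]
    ring
  simp only [Set.mem_iUnion]
  refine ⟨fun n => c⁻¹ * z n, ⟨?_, F fun n => c⁻¹ * z n, ⟨?_, fun n => rfl⟩, ?_, ?_⟩, c, ?_, ?_⟩
  · rw [← mul_sub, ← hc, inv_mul_cancel₀ hc0]
  · exact fun j k hjk => hzinj (mul_left_cancel₀ (inv_ne_zero hc0) hjk)
  · intro j k hjk
    rw [hF, hF] at hjk
    exact hwinj (mul_left_cancel₀ (mul_ne_zero hc0 (inv_ne_zero hΛ0)) hjk)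
  · intro n
    have e : Λ ^ 2 * (c⁻¹ * z n) = Λ * c⁻¹ * (Λ * z n) := by ring
    rw [e, hz', Finset.mul_sum]
    refine Finset.sum_congr rfl fun j _ => ?_
    rw [hF, hF, ← mul_sub]
    simp only [strength, Algebra.algebraMap_self, RingHom.id_apply, div_eq_mul_inv, mul_inv,
      inv_inv]
    ring
  · change c ^ 2 = _
    rw [hF, hF, ← mul_sub, ← h10, ← hc]
    field_simp
  · have hcz : (fun n => c * (c⁻¹ * z n)) = z := funext fun n => mul_inv_cancel_left₀ hc0 _
    change configOfPositions Γ Λ (fun n => c * (c⁻¹ * z n)) = _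
    rw [hcz]
    simp only [configOfPositions, ← hw']
    rw [show Z = _ from funext₂ hZinv, show W = _ from funext₂ hWinv]

end FourVortex

end

theorem theorem6p1 (Γ : Fin 4 → ℝ) (hΓ : ∀ n, Γ n ≠ 0)
    (hL : FourVortex.angularMomentum Γ = 0) :
    -- relative equilibria, in the plane and in the complex domain
    (FourVortex.FiniteUpToSimilarity {z | FourVortex.IsRelativeEquilibrium Γ z} ∧
      {Q | ∃ l : ℝ, |l| = 1 ∧ FourVortex.IsNormalizedCentral Γ (l : ℂ) Q}.Finite) ∧
    -- collapse configurations, in the plane and in the complex domain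
    (∀ Λ : ℂ, ‖Λ‖ = 1 → Λ.im ≠ 0 →
      ¬ (FourVortex.IsExceptional Γ ∧ (Λ = Complex.I ∨ Λ = -Complex.I)) →
      FourVortex.FiniteUpToSimilarity {z | FourVortex.IsCollapseConfiguration Γ Λ z} ∧
        {Q | FourVortex.IsNormalizedCentral Γ Λ Q}.Finite) := by
  refine ⟨⟨?_, ?_⟩, fun Λ hΛ _ _ => ⟨?_, FourVortex.finite_normalizedCentral hΓ hL hΛ⟩⟩
  -- All real `l ≠ 0` share the same quotient `l / conj l = 1`, so one dual system covers every
  -- relative equilibrium.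
  · refine FourVortex.finiteUpToSimilarity_of_velocity hΓ hL (lam := 1) norm_one ?_
    rintro z ⟨hinj, l, z₀, hl, hv⟩
    have hl' : (l : ℂ) ≠ 0 := Complex.ofReal_ne_zero.2 hl
    exact ⟨hinj, l, z₀, hl', by rw [Complex.conj_ofReal, div_self hl'], hv⟩
  · refine ((FourVortex.finite_normalizedCentral (Λ := 1) hΓ hL norm_one).union
      (FourVortex.finite_normalizedCentral (Λ := -1) hΓ hL (by simp))).subset ?_
    rintro Q ⟨l, hl, hQ⟩
    rcases (abs_eq zero_le_one).1 hl with rfl | rfl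
    · exact .inl (by simpa using hQ)
    · exact .inr (by simpa using hQ)
  · have hΛ0 : Λ ≠ 0 := by rintro rfl; simp at hΛ
    refine FourVortex.finiteUpToSimilarity_of_velocity hΓ hL
      (lam := Λ / (starRingEnd ℂ) Λ) ?_ ?_
    · rw [norm_div, RCLike.norm_conj, hΛ, div_one]
    · rintro z ⟨hinj, _, z₀, hv⟩
      exact ⟨hinj, Λ, z₀, hΛ0, rfl, hv⟩
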